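/- Setting. Let $d,m\ge 1$ and $\sigma_1,\dots,\sigma_m>0$. There are $m$ linear regression instances with parameters $\beta_i\in\mathbb{R}^d$. At each round $t=1,\dots,n$ a context $X_t\sim\mathcal N(0,\Sigma)$ is drawn i.i.d. ($\Sigma$ positive definite and known), an instance $I_t\in[m]$ is selected, and $Y_{I_t,t}=X_t^{\mathsf T}\beta_{I_t}+\epsilon_{I_t,t}$ is observed, where the noises $\epsilon_{i,t}\sim\mathcal N(0,\sigma_i^2)$ are independent of each other and of the contexts. Let $k_{i,t}$ be the number of rounds $s\le t$ with $I_s=i$, let $\mathbf X_{i,t},\mathbf Y_{i,t}$ be the contexts and responses of these rounds, and put $\hat\Sigma_{i,t}=\mathbf X_{i,t}^{\mathsf T}\mathbf X_{i,t}/k_{i,t}$, $\hat\beta_{i,t}=(\mathbf X_{i,t}^{\mathsf T}\mathbf X_{i,t})^{-1}\mathbf X_{i,t}^{\mathsf T}\mathbf Y_{i,t}$, $\hat\sigma^2_{i,t}=\frac{1}{k_{i,t}-d}\|\mathbf Y_{i,t}-\mathbf X_{i,t}\hat\beta_{i,t}\|^2$. Trace-UCB. Given $n$, $\Sigma$, $\delta$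 and $R\ge\max_i\sigma_i^2$, the algorithm first selects every instance exactly $d+1$ times, one instance after the other; at each round $t>m(d+1)$ it selects, as a measurable function of the data of the previous rounds only, some $$I_t\in\arg\max_{i\in[m]}\ \frac{\hat\sigma^2_{i,t-1}+\Delta_{i,t-1}}{k_{i,t-1}}\,\mathrm{Tr}\big(\Sigma\hat\Sigma_{i,t-1}^{-1}\big),\qquad \Delta_{i,t}=R\sqrt{\frac{64}{k_{i,t}-d}\Big(\log\frac{2mn}{\delta}\Big)^2}.$$ Theorem. Put $$k^*_{i,n}=\frac{\sigma_i^2}{\sum_j\sigma_j^2}\,n+(d+1)\Big(1-\frac{\sigma_i^2}{\frac1m\sum_j\sigma_j^2}\Big)$$ (the optimal static allocation, up to rounding), $\sigma_{\min}^2=\min_i\sigma_i^2$, $\lambda_{\min}=\sigma_{\min}^2/\sum_j\sigma_j^2$, $C_\Delta=16R\log(2mn/\delta)$ and $C_{\mathrm{Tr}}=1+\sqrt{2\log(4nm/\delta)/d}$. There is a constant $c>0$ depending only on $d$, $m$ and $\sigma_1,\dots,\sigma_m$ such that for every $n>m(d+1)$, $\delta>0$, $R\ge\max_i\sigma_i^2$,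 $\Sigma$ and $\beta_1,\dots,\beta_m$, with probability at least $1-\delta$, Trace-UCB satisfies simultaneously for all $i\in[m]$ $$k_{i,n}\ \ge\ k^*_{i,n}-\frac{C_\Delta+8C_{\mathrm{Tr}}}{\sigma_{\min}^2}\sqrt{\frac{nd}{\lambda_{\min}}}-c\,n^{1/4}.$$ -/

import Mathlib

namespace TraceUCB

/-- One round of interaction `(X_t, I_t, Y_{I_t,t})`: context, selected instance, response. -/
abbrev Obs (d m : ℕ) : Type := EuclideanSpace ℝ (Fin d) × Fin m × ℝ

/-- The data collected during the first `t` rounds. -/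
abbrev History (d m t : ℕ) : Type := Fin t → Obs d m

/-- An allocation rule: the instance for the next round as a function of the past data only
(the current context is not an argument). -/
abbrev Policy (d m : ℕ) : Type := (t : ℕ) → History d m t → Fin m

section Statistics

variable {d m t : ℕ}

/-- The rounds in which instance `i` was selected. -/
abbrev Rounds (i : Fin m) (h : History d m t) : Type := {s : Fin t // (h s).2.1 = i}

/-- Number of contexts allocated to instance `i`. -/
def pulls (i : Fin m) (h : History d m t) : ℕ := Fintype.card (Rounds i h)

/-- Sample matrix of instance `i`; its rows are the contexts allocated to `i`. -/
def design (i : Fin m) (h : History d m t) : Matrix (Rounds i h) (Fin d) ℝ :=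
  Matrix.of fun s j => (h s.1).1 j

/-- Vector of the responses observed from instance `i`. -/
def response (i : Fin m) (h : History d m t) : Rounds i h → ℝ := fun s => (h s.1).2.2

/-- Empirical covariance `XᵀX / k` of the contexts allocated to instance `i`. -/
noncomputable def empCov (i : Fin m) (h : History d m t) : Matrix (Fin d) (Fin d) ℝ :=
  ((pulls i h : ℝ)⁻¹) • ((design i h).transpose * design i h)

/-- Ordinary least squares estimate `(XᵀX)⁻¹ XᵀY` for instance `i`. -/
noncomputable def olsEst (i : Fin m) (h : History d m t) : Fin d → ℝ :=
  ((design i h).transpose * design i h)⁻¹.mulVec ((design i h).transpose.mulVec (response i h))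

/-- Variance estimate `‖Y - X β̂‖² / (k - d)` for instance `i`. -/
noncomputable def varEst (i : Fin m) (h : History d m t) : ℝ :=
  1 / ((pulls i h : ℝ) - d) *
    ∑ s, (response i h s - (design i h).mulVec (olsEst i h) s) ^ 2

/-- Confidence width `Δ` of the variance estimate, for horizon `n`, confidence `δ` and
variance bound `R`. -/
noncomputable def width (n : ℕ) (δ R : ℝ) (i : Fin m) (h : History d m t) : ℝ :=
  R * Real.sqrt (64 / ((pulls i h : ℝ) - d) * Real.log (2 * m * n / δ) ^ 2)

/-- The index maximized by the algorithm. -/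
noncomputable def score (n : ℕ) (δ R : ℝ) (S : Matrix (Fin d) (Fin d) ℝ)
    (i : Fin m) (h : History d m t) : ℝ :=
  (varEst i h + width n δ R i h) / (pulls i h : ℝ) * (S * (empCov i h)⁻¹).trace

end Statistics

/-- `π` is a version of Trace-UCB for horizon `n`, confidence `δ`, variance bound `R` and context
covariance `S`: each instance is first selected `d + 1` times in turn, and afterwards an instance
of maximal score is selected, ties being broken by any measurable rule. Round `t + 1` is
decided by `π t`. -/
structure IsTraceUCB {d m : ℕ} (n : ℕ) (δ R : ℝ) (S : Matrix (Fin d) (Fin d) ℝ)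
    (π : Policy d m) : Prop where
  measurable : ∀ t, Measurable (π t)
  warmup : ∀ t, t < m * (d + 1) → ∀ h, ((π t h : Fin m) : ℕ) = t / (d + 1)
  argmax : ∀ t, m * (d + 1) ≤ t → t < n → ∀ (h : History d m t) (j : Fin m),
    score n δ R S j h ≤ score n δ R S (π t h) h

/-- Data produced by the rule `π` when the regression parameters are `β`, the contexts are
`x 0, x 1, …` and `e t i` is the noise of instance `i` in round `t`. -/
noncomputable def run {d m : ℕ} (π : Policy d m) (β : Fin m → EuclideanSpace ℝ (Fin d))
    (x : ℕ → EuclideanSpace ℝ (Fin d)) (e : ℕ → Fin m → ℝ) : (t : ℕ) → History d m t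
  | 0 => Fin.elim0
  | t + 1 =>
    let h := run π β x e t
    let i := π t h
    Fin.snoc (α := fun _ => Obs d m) h (x t, i, (x t).ofLp ⬝ᵥ (β i).ofLp + e t i)

/-- The stochastic model: the pairs `(X_t, (ε_{i,t})_i)` are independent over `t`, with
`X_t ∼ N(0, S)` and, independently of it, independent noises `ε_{i,t} ∼ N(0, σ_i²)`. -/
structure IsModel {d m : ℕ} {Ω : Type*} [MeasurableSpace Ω] (P : MeasureTheory.Measure Ω)
    (S : Matrix (Fin d) (Fin d) ℝ) (σ : Fin m → ℝ)
    (X : ℕ → Ω → EuclideanSpace ℝ (Fin d)) (ε : ℕ → Ω → Fin m → ℝ) : Prop where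
  law : ∀ t, ProbabilityTheory.HasLaw (fun ω => (X t ω, ε t ω))
    ((ProbabilityTheory.multivariateGaussian 0 S).prod
      (MeasureTheory.Measure.pi fun i =>
        ProbabilityTheory.gaussianReal 0 (Real.toNNReal (σ i ^ 2)))) P
  indep : ProbabilityTheory.iIndepFun (fun t ω => (X t ω, ε t ω)) P

/-- Optimal static allocation `k*_{i,n}` (without rounding). -/
noncomputable def optAlloc {m : ℕ} (d n : ℕ) (σ : Fin m → ℝ) (i : Fin m) : ℝ :=
  σ i ^ 2 / (∑ j, σ j ^ 2) * n + (d + 1) * (1 - σ i ^ 2 / ((1 / (m : ℝ)) * ∑ j, σ j ^ 2))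

/-- `σ_min²`. -/
noncomputable def varMin {m : ℕ} (σ : Fin m → ℝ) : ℝ := ⨅ i, σ i ^ 2

/-- `λ_min = σ_min² / ∑ σ_j²`. -/
noncomputable def lamMin {m : ℕ} (σ : Fin m → ℝ) : ℝ := varMin σ / ∑ j, σ j ^ 2

/-- `C_Δ = 16 R log (2mn/δ)`. -/
noncomputable def CDelta (m n : ℕ) (δ R : ℝ) : ℝ := 16 * R * Real.log (2 * m * n / δ)

/-- `C_Tr = 1 + √(2 log (4nm/δ) / d)`. -/
noncomputable def CTr (d m n : ℕ) (δ : ℝ) : ℝ :=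
  1 + Real.sqrt (2 * Real.log (4 * n * m / δ) / d)

/-- The real allocation `optAlloc` has total `n`, gives every instance more than `d + 1` contexts,
and minimizes the largest static loss `d σ_i² / (k_i - d - 1)` among all such allocations. -/
theorem optAlloc_optimal {m : ℕ} (d n : ℕ) (σ : Fin m → ℝ) (hm : 1 ≤ m) (hσ : ∀ i, 0 < σ i)
    (hn : m * (d + 1) < n) :
    (∑ i, optAlloc d n σ i = n) ∧ (∀ i, (d : ℝ) + 1 < optAlloc d n σ i) ∧
      ∀ k : Fin m → ℝ, ∑ i, k i = n → (∀ i, (d : ℝ) + 1 < k i) →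
        ∃ j, ∀ i, d * σ i ^ 2 / (optAlloc d n σ i - d - 1) ≤ d * σ j ^ 2 / (k j - d - 1) := by
  have hne : Nonempty (Fin m) := ⟨⟨0, hm⟩⟩
  have hm0 : (0 : ℝ) < m := by exact_mod_cast hm
  have hT : 0 < ∑ j, σ j ^ 2 :=
    Finset.sum_pos (fun i _ => pow_pos (hσ i) 2) Finset.univ_nonempty
  have hN : (0 : ℝ) < n - m * (d + 1) := by
    have : ((m * (d + 1) : ℕ) : ℝ) < n := by exact_mod_cast hn
    push_cast at this
    linarith
  have key : ∀ i, optAlloc d n σ i =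
      d + 1 + σ i ^ 2 * ((n - m * (d + 1)) / ∑ j, σ j ^ 2) := by
    intro i
    unfold optAlloc
    field_simp
    ring
  have hsum : ∑ i, optAlloc d n σ i = n := by
    simp only [key, Finset.sum_add_distrib, ← Finset.sum_mul]
    simp only [Finset.sum_const, Finset.card_univ, Fintype.card_fin, nsmul_eq_mul]
    field_simp
    ring
  have hgt : ∀ i, (d : ℝ) + 1 < optAlloc d n σ i := by
    intro i
    rw [key]
    have := mul_pos (pow_pos (hσ i) 2) (div_pos hN hT)
    linarith
  refine ⟨hsum, hgt, fun k hk hk1 => ?_⟩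
  obtain ⟨j, hj⟩ : ∃ j, k j ≤ optAlloc d n σ j := by
    by_contra! hcon
    have := Finset.sum_lt_sum_of_nonempty (s := Finset.univ) Finset.univ_nonempty
      (fun i _ => hcon i)
    rw [hsum, hk] at this
    exact lt_irrefl _ this
  refine ⟨j, fun i => ?_⟩
  have hi : d * σ i ^ 2 / (optAlloc d n σ i - d - 1) =
      d * σ j ^ 2 / (optAlloc d n σ j - d - 1) := by
    have h1 := hσ i
    have h2 := hσ j
    rw [key, key]
    have e : ∀ z : ℝ, (d : ℝ) + 1 + z - d - 1 = z := fun z => by ring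
    rw [e, e]
    field_simp
  rw [hi]
  have h1 := hk1 j
  exact div_le_div_of_nonneg_left (by positivity) (by linarith) (by linarith)

end TraceUCB

/-! Write L = log(2mn/δ). The argument has a probabilistic half, which bounds all statistics at
once, and a deterministic half, which compares two scores.

Probability. When an instance has k > d rows, its residual sum of squares divided by σ² lies between
the squared distance of a standard Gaussian vector to the column space of the design (chi-square, k
- d degrees of freedom) and the squared norm of that vector (chi-square, k degrees). After whitening
by Σ^(-1/2), the trace factor becomes k · Tr((GᵀG)⁻¹) with G a standard Gaussian matrix. The j-th
diagonal entry of (GᵀG)⁻¹ is the inverse squared distance from column j to the span of the others,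
so it is controlled by chi-squares with k - d + 1 and k degrees. Rows are allocated adaptively, but
the allocation never looks at the current round. Optional skipping (`measure_skipEvent_le`)
therefore transfers the i.i.d. estimates to the first k rows of each instance, and a union over
instances and counts k gives `measure_not_statBounds_le`.

Determinism. On the good event the width pays for both the variance deviation and the trace deficit,
so a score is at least σ²d/k with no error term (`le_score`). With y = √(k - d) ≥ 11L it is at most
d(σ² + 15.5RL/y)/y² (`score_le`). Since the optimal allocations sum to n, some instance j receives
at least its optimal share. At its last pull, j beat i, and the inequality between these two bounds
is solved for the count of i (`allocation_bound`). The loss is at most C_Δ/σ_min² · √(n/λ_min) + d +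
1, as stated in `optAlloc_sub_le_pulls`.

Values of n below a constant are absorbed in c. The term `CTr` enters only as nonnegative slack, and
n^(1/4) only through being at least 1. -/

namespace TraceUCB
open MeasureTheory ProbabilityTheory

/-! ### Chernoff bounds for chi-square variables. -/

section ChiSquare

theorem gaussian_exp_mul_sq_eq (t x : ℝ) :
    gaussianPDFReal 0 1 x • Real.exp (t * x ^ 2)
      = (√(2 * Real.pi))⁻¹ * Real.exp (-(1 / 2 - t) * x ^ 2) := by
  simp only [gaussianPDFReal, NNReal.coe_one, mul_one, sub_zero, smul_eq_mul]
  rw [mul_assoc, ← Real.exp_add]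
  congr 2
  ring

theorem integrable_exp_mul_sq_gaussian {t : ℝ} (ht : t < 1 / 2) :
    Integrable (fun x : ℝ => Real.exp (t * x ^ 2)) (gaussianReal 0 1) := by
  rw [gaussianReal_of_var_ne_zero _ one_ne_zero,
    integrable_withDensity_iff_integrable_smul' (measurable_gaussianPDF _ _)
      (Filter.Eventually.of_forall fun _ => gaussianPDF_lt_top)]
  simp only [toReal_gaussianPDF, gaussian_exp_mul_sq_eq]
  exact (integrable_exp_neg_mul_sq (by linarith)).const_mul _

theorem integral_exp_mul_sq_gaussian {t : ℝ} (ht : t < 1 / 2) :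
    ∫ x : ℝ, Real.exp (t * x ^ 2) ∂(gaussianReal 0 1) = (√(1 - 2 * t))⁻¹ := by
  rw [integral_gaussianReal_eq_integral_smul one_ne_zero]
  simp only [gaussian_exp_mul_sq_eq]
  rw [integral_const_mul, integral_gaussian, ← Real.sqrt_inv, ← Real.sqrt_mul (by positivity),
    ← Real.sqrt_inv]
  congr 1
  have : 1 / 2 - t ≠ 0 := by linarith
  have : 1 - 2 * t ≠ 0 := by linarith
  have := Real.pi_ne_zero
  field_simp

variable {ι : Type*} [Fintype ι]

theorem exp_mul_sum_sq_eq_prod [DecidableEq ι] (s : Finset ι) (t : ℝ) (x : ι → ℝ) :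
    Real.exp (t * ∑ i ∈ s, x i ^ 2) = ∏ i, Real.exp ((if i ∈ s then t else 0) * x i ^ 2) := by
  rw [← Real.exp_sum, Finset.mul_sum, ← Finset.sum_subset (Finset.subset_univ s)]
  · congr 1
    exact Finset.sum_congr rfl fun i hi => by simp [hi]
  · intro i _ hi
    simp [hi]

theorem integrable_exp_mul_sum_sq (s : Finset ι) {t : ℝ} (ht : t < 1 / 2) :
    Integrable (fun x : ι → ℝ => Real.exp (t * ∑ i ∈ s, x i ^ 2))
      (Measure.pi fun _ => gaussianReal 0 1) := by
  classical
  simp only [exp_mul_sum_sq_eq_prod]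
  refine Integrable.fintype_prod (f := fun i (y : ℝ) => Real.exp ((if i ∈ s then t else 0) * y ^ 2))
    fun i => integrable_exp_mul_sq_gaussian ?_
  split_ifs <;> linarith

theorem mgf_sum_sq (s : Finset ι) {t : ℝ} (ht : t < 1 / 2) :
    mgf (fun x : ι → ℝ => ∑ i ∈ s, x i ^ 2) (Measure.pi fun _ => gaussianReal 0 1) t
      = (√(1 - 2 * t))⁻¹ ^ s.card := by
  classical
  unfold mgf
  simp only [exp_mul_sum_sq_eq_prod]
  rw [integral_fintype_prod_eq_prod
    (f := fun i (y : ℝ) => Real.exp ((if i ∈ s then t else 0) * y ^ 2))]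
  rw [← Finset.prod_subset (Finset.subset_univ s)]
  · rw [← Finset.prod_const]
    exact Finset.prod_congr rfl fun i hi => by simp [hi, integral_exp_mul_sq_gaussian ht]
  · intro i _ hi
    simp [hi]

theorem chiSq_lower_le (s : Finset ι) (a : ℝ) {t : ℝ} (ht : 0 ≤ t) :
    (Measure.pi fun _ : ι => gaussianReal 0 1).real {x | ∑ i ∈ s, x i ^ 2 ≤ a}
      ≤ Real.exp (t * a) * (√(1 + 2 * t))⁻¹ ^ s.card := by
  have h := measure_le_le_exp_mul_mgf (μ := Measure.pi fun _ : ι => gaussianReal 0 1)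
    (X := fun x : ι → ℝ => ∑ i ∈ s, x i ^ 2) a (t := -t) (by linarith)
    (integrable_exp_mul_sum_sq s (by linarith))
  rw [mgf_sum_sq s (by linarith)] at h
  simpa using h

theorem chiSq_upper_le (s : Finset ι) (a : ℝ) {t : ℝ} (ht : 0 ≤ t) (ht' : t < 1 / 2) :
    (Measure.pi fun _ : ι => gaussianReal 0 1).real {x | a ≤ ∑ i ∈ s, x i ^ 2}
      ≤ Real.exp (-t * a) * (√(1 - 2 * t))⁻¹ ^ s.card := by
  have h := measure_ge_le_exp_mul_mgf (μ := Measure.pi fun _ : ι => gaussianReal 0 1)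
    (X := fun x : ι → ℝ => ∑ i ∈ s, x i ^ 2) a ht (integrable_exp_mul_sum_sq s ht')
  rwa [mgf_sum_sq s ht'] at h

theorem inv_sqrt_le_exp {u v : ℝ} (hu : 0 < u) (h : -v ≤ Real.log u) :
    (√u)⁻¹ ≤ Real.exp (v / 2) := by
  rw [← Real.sqrt_inv]
  apply Real.sqrt_le_iff.2 ⟨(Real.exp_pos _).le, ?_⟩
  rw [← Real.exp_nat_mul, ← Real.exp_log (inv_pos.2 hu), Real.exp_le_exp, Real.log_inv]
  push_cast
  linarith

theorem log_one_add_ge {u : ℝ} (hu : 0 ≤ u) : u - u ^ 2 / 2 ≤ Real.log (1 + u) := by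
  have h := Real.le_log_one_add_of_nonneg hu
  refine le_trans ?_ h
  rw [le_div_iff₀ (by linarith)]
  nlinarith [pow_nonneg hu 3]

theorem log_one_sub_ge {u : ℝ} (hu' : u ≤ 2 / 3) :
    -(u + 3 * u ^ 2) ≤ Real.log (1 - u) := by
  have h1 : 0 < 1 - u := by linarith
  refine le_trans ?_ (Real.one_sub_inv_le_log_of_pos h1)
  rw [← sub_nonneg]
  have : 1 - (1 - u)⁻¹ - -(u + 3 * u ^ 2) = u ^ 2 * (2 - 3 * u) / (1 - u) := by
    field_simp; ring
  rw [this]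
  exact div_nonneg (mul_nonneg (sq_nonneg _) (by linarith)) h1.le

theorem chiSq_upper_tail (s : Finset ι) (hs : s.Nonempty) (x : ℝ) :
    (Measure.pi fun _ : ι => gaussianReal 0 1).real
        {z | s.card + (3 * x + 2) * √s.card ≤ ∑ i ∈ s, z i ^ 2} ≤ Real.exp (-x) := by
  set k : ℝ := (s.card : ℝ) with hk
  have hk1 : 1 ≤ k := by rw [hk]; exact_mod_cast hs.card_pos
  have hr1 : 1 ≤ √k := Real.one_le_sqrt.2 hk1
  have hr2 : √k ^ 2 = k := Real.sq_sqrt (by linarith)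
  set r := √k
  have hr0 : r ≠ 0 := by positivity
  -- The Chernoff parameter is t = 1/(3√k); then 2t ≤ 2/3, the range of `log_one_sub_ge`, and the
  -- exponent is exactly -x.
  have ht : (3 * r)⁻¹ ≤ 1 / 3 := by
    rw [inv_le_comm₀ (by positivity) (by norm_num)]; linarith
  have ht0 : 0 ≤ (3 * r)⁻¹ := by positivity
  refine (chiSq_upper_le s _ ht0 (by linarith)).trans ?_
  have h1 : (√(1 - 2 * (3 * r)⁻¹))⁻¹ ≤
      Real.exp ((2 * (3 * r)⁻¹ + 3 * (2 * (3 * r)⁻¹) ^ 2) / 2) :=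
    inv_sqrt_le_exp (by linarith) (log_one_sub_ge (by linarith))
  have h2 := pow_le_pow_left₀ (by positivity) h1 s.card
  refine (mul_le_mul_of_nonneg_left h2 (Real.exp_pos _).le).trans ?_
  rw [← Real.exp_nat_mul, ← Real.exp_add, Real.exp_le_exp, ← hk, ← hr2]
  apply le_of_eq
  field_simp
  ring

theorem chiSq_lower_tail (s : Finset ι) (hs : s.Nonempty) {x : ℝ} (hx : 0 ≤ x) :
    (Measure.pi fun _ : ι => gaussianReal 0 1).real
        {z | ∑ i ∈ s, z i ^ 2 ≤ s.card - 2 * √(s.card * x)} ≤ Real.exp (-x) := by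
  set k : ℝ := (s.card : ℝ) with hk
  have hk1 : 1 ≤ k := by rw [hk]; exact_mod_cast hs.card_pos
  set r := √(k * x)
  have hr2 : r ^ 2 = k * x := Real.sq_sqrt (by positivity)
  have hr0 : 0 ≤ r := Real.sqrt_nonneg _
  have ht0 : 0 ≤ r / k := by positivity
  -- The parameter t = √(x/k) minimizes the quadratic exponent kt² - 2t√(kx).
  refine (chiSq_lower_le s _ ht0).trans ?_
  have h1 : (√(1 + 2 * (r / k)))⁻¹ ≤
      Real.exp (-(2 * (r / k) - (2 * (r / k)) ^ 2 / 2) / 2) :=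
    inv_sqrt_le_exp (by linarith) (by simpa using log_one_add_ge (u := 2 * (r / k)) (by positivity))
  have h2 := pow_le_pow_left₀ (by positivity) h1 s.card
  refine (mul_le_mul_of_nonneg_left h2 (Real.exp_pos _).le).trans ?_
  rw [← Real.exp_nat_mul, ← Real.exp_add, Real.exp_le_exp, ← hk]
  apply le_of_eq
  have hx' : x = r ^ 2 / k := by rw [hr2]; field_simp
  rw [hx']
  field_simp
  ring

/-- For few degrees of freedom the radius of `chiSq_lower_tail` may be negative. A positive radius
is still required, since invertibility of the Gram matrix rests on it. With a = 1/t the Chernoff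
prefactor is e, and one factor (1 + 2t)^(-1/2) already suffices. -/
theorem exists_chiSq_small_ball (s : Finset ι) (hs : s.Nonempty) (x : ℝ) :
    ∃ a : ℝ, 0 < a ∧ (Measure.pi fun _ : ι => gaussianReal 0 1).real
        {z | ∑ i ∈ s, z i ^ 2 ≤ a} ≤ Real.exp (-x) := by
  set t : ℝ := Real.exp (2 * (x + 1)) with ht
  have ht0 : 0 < t := Real.exp_pos _
  refine ⟨t⁻¹, inv_pos.2 ht0, (chiSq_lower_le s _ ht0.le).trans ?_⟩
  rw [mul_inv_cancel₀ ht0.ne']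
  have h1 : (√(1 + 2 * t))⁻¹ ≤ Real.exp (-(2 * (x + 1)) / 2) := by
    refine inv_sqrt_le_exp (by positivity) ?_
    rw [neg_neg]
    conv_lhs => rw [← Real.log_exp (2 * (x + 1)), ← ht]
    exact Real.log_le_log ht0 (by linarith)
  have h2 : (√(1 + 2 * t))⁻¹ ≤ 1 := by
    apply inv_le_one_of_one_le₀
    rw [Real.one_le_sqrt]
    linarith
  have h3 : (√(1 + 2 * t))⁻¹ ^ s.card ≤ (√(1 + 2 * t))⁻¹ :=
    pow_le_of_le_one (by positivity) h2 hs.card_pos.ne'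
  calc _ ≤ Real.exp 1 * Real.exp (-(2 * (x + 1)) / 2) := by gcongr; exact h3.trans h1
    _ = _ := by rw [← Real.exp_add]; congr 1; ring

/-- A positive radius below which a chi-square variable with `N` degrees of freedom falls with
probability at most `exp (-x)`, not smaller than `N - 2 √(N x)`. -/
theorem exists_chiSq_radius (s : Finset ι) (hs : s.Nonempty) {x : ℝ} (hx : 0 ≤ x) :
    ∃ a : ℝ, 0 < a ∧ s.card - 2 * √(s.card * x) ≤ a ∧
      (Measure.pi fun _ : ι => gaussianReal 0 1)
        {z | ∑ i ∈ s, z i ^ 2 ≤ a} ≤ ENNReal.ofReal (Real.exp (-x)) := by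
  obtain ⟨a, ha, h⟩ := exists_chiSq_small_ball s hs x
  refine ⟨max a (s.card - 2 * √(s.card * x)), lt_max_of_lt_left ha, le_max_right _ _, ?_⟩
  rw [← ofReal_measureReal]
  apply ENNReal.ofReal_le_ofReal
  rcases max_choice a (s.card - 2 * √(s.card * x)) with h1 | h1 <;> rw [h1]
  · exact h
  · exact chiSq_lower_tail s hs hx

end ChiSquare

/-! ### Distance of a Gaussian vector to a subspace. -/

section Distance

/-- A standard Gaussian vector is at least as far from a subspace of dimension at most `p` as a
standard Gaussian vector is from the origin in the orthogonal directions. -/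
theorem gaussian_dist_range_le {k p N : ℕ} (hN : p + N ≤ k) (B : Fin k → Fin p → ℝ) (a : ℝ) :
    (Measure.pi fun _ : Fin k => gaussianReal 0 1)
        {g | ∃ c : Fin p → ℝ, ∑ l, (g l - ∑ j, B l j * c j) ^ 2 < a}
      ≤ (Measure.pi fun _ : Fin k => gaussianReal 0 1)
        {z | ∑ i ∈ Finset.univ.filter (fun i : Fin k => (i : ℕ) < N), z i ^ 2 ≤ a} := by
  let u : Fin p → EuclideanSpace ℝ (Fin k) := fun j => WithLp.toLp 2 fun l => B l j
  let U : Submodule ℝ (EuclideanSpace ℝ (Fin k)) := Submodule.span ℝ (Set.range u)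
  have hU : Module.finrank ℝ U ≤ p := by
    simpa [Set.finrank] using finrank_range_le_card (R := ℝ) u
  have hV : N ≤ Module.finrank ℝ Uᗮ := by
    have := U.finrank_add_finrank_orthogonal
    have hE : Module.finrank ℝ (EuclideanSpace ℝ (Fin k)) = k := finrank_euclideanSpace_fin
    omega
  let w := stdOrthonormalBasis ℝ Uᗮ
  let v : Fin k → EuclideanSpace ℝ (Fin k) := fun i =>
    if h : (i : ℕ) < N then (w (Fin.castLE hV ⟨i, h⟩) : EuclideanSpace ℝ (Fin k)) else 0
  -- An orthonormal basis whose first N vectors are orthogonal to the subspace. By rotation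
  -- invariance the coordinates in it are again i.i.d. standard Gaussian, and subtracting a vector
  -- of the subspace leaves the first N unchanged.
  obtain ⟨b, hb⟩ := Orthonormal.exists_orthonormalBasis_extension_of_card_eq (𝕜 := ℝ) (E := EuclideanSpace ℝ (Fin k))
    (ι := Fin k) (by simp) (v := v) (s := {i | (i : ℕ) < N}) (by
      rw [orthonormal_iff_ite]
      rintro ⟨i, hi⟩ ⟨j, hj⟩
      simp only [Set.mem_ofPred_eq] at hi hj
      have h1 := orthonormal_iff_ite.1 w.orthonormal (Fin.castLE hV ⟨i, hi⟩)
        (Fin.castLE hV ⟨j, hj⟩)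
      simp only [Set.domRestrict_apply, v, hi, hj, dif_pos]
      rw [Submodule.coe_inner] at h1
      rw [h1]
      simp [Fin.ext_iff])
  have hbU : ∀ i : Fin k, (i : ℕ) < N → b i ∈ Uᗮ := by
    intro i hi
    rw [hb i hi]
    simp only [v, hi, dif_pos]
    exact Submodule.coe_mem _
  have hlaw := stdGaussian_eq_map_pi_orthonormalBasis b
  rw [← map_pi_eq_stdGaussian] at hlaw
  have hopen : IsOpen {g : EuclideanSpace ℝ (Fin k) | ∃ c : Fin p → ℝ, ∑ l, (g l - ∑ j, B l j * c j) ^ 2 < a} := by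
    simp only [Set.ofPred_exists]
    refine isOpen_iUnion fun c => isOpen_lt ?_ continuous_const
    fun_prop
  have h1 := congrArg (fun μ => μ {g : EuclideanSpace ℝ (Fin k) | ∃ c : Fin p → ℝ, ∑ l, (g l - ∑ j, B l j * c j) ^ 2 < a})
    hlaw
  simp only at h1
  rw [Measure.map_apply (by fun_prop) hopen.measurableSet,
    Measure.map_apply (by fun_prop) hopen.measurableSet] at h1
  refine (le_of_eq h1).trans (measure_mono ?_)
  rintro z ⟨c, hc⟩
  simp only [Set.mem_ofPred_eq]
  refine le_trans ?_ hc.le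
  set g : EuclideanSpace ℝ (Fin k) := ∑ i, z i • b i
  set y : EuclideanSpace ℝ (Fin k) := g - ∑ j, c j • u j
  have hy : ∑ l, (g l - ∑ j, B l j * c j) ^ 2 = ‖y‖ ^ 2 := by
    rw [EuclideanSpace.real_norm_sq_eq]
    refine Finset.sum_congr rfl fun l _ => ?_
    simp [y, u, mul_comm (c _)]
  change _ ≤ ∑ l, (g l - ∑ j, B l j * c j) ^ 2
  rw [hy, ← b.sum_sq_inner_right]
  refine (Finset.sum_congr rfl fun i hi => ?_).trans_le
    (Finset.sum_le_sum_of_subset_of_nonneg (Finset.subset_univ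
      (Finset.univ.filter fun i : Fin k => (i : ℕ) < N)) fun _ _ _ => sq_nonneg _)
  congr 1
  have h2 : inner ℝ (b i) (∑ j, c j • u j) = 0 := by
    refine Submodule.inner_left_of_mem_orthogonal (K := U) ?_ (hbU i (by simpa using hi))
    exact Submodule.sum_mem _ fun j _ =>
      Submodule.smul_mem _ _ (Submodule.subset_span ⟨j, rfl⟩)
  have h3 : inner ℝ (b i) g = z i := by
    simp [g, inner_sum, inner_smul_right, orthonormal_iff_ite.1 b.orthonormal]
  simp only [y, inner_sub_right, h2, h3, sub_zero]

end Distance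
end TraceUCB

namespace TraceUCB
open MeasureTheory ProbabilityTheory

/-! ### Tail bounds for i.i.d. rows. -/

section Rows

/-- A positive radius such that a standard Gaussian vector of length `k` is within this (squared)
distance of a given `p`-dimensional subspace with probability at most `exp (-x)`. -/
theorem exists_radius {k p N : ℕ} (hN : p + N ≤ k) (hN1 : 1 ≤ N) {x : ℝ} (hx : 0 ≤ x) :
    ∃ a : ℝ, 0 < a ∧ N - 2 * √(N * x) ≤ a ∧ ∀ B : Fin k → Fin p → ℝ,
      (Measure.pi fun _ : Fin k => gaussianReal 0 1)
        {g | ∃ c : Fin p → ℝ, ∑ l, (g l - ∑ j, B l j * c j) ^ 2 < a}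
        ≤ ENNReal.ofReal (Real.exp (-x)) := by
  have hcard : (Finset.univ.filter fun i : Fin k => (i : ℕ) < N).card = N := by
    rw [Fin.card_filter_val_lt]
    omega
  obtain ⟨a, ha, ha', h⟩ := exists_chiSq_radius
    (Finset.univ.filter fun i : Fin k => (i : ℕ) < N) (Finset.card_pos.1 (by omega)) hx
  rw [hcard] at ha'
  exact ⟨a, ha, ha', fun B => (gaussian_dist_range_le hN B a).trans h⟩

variable {Z : Type*} [MeasurableSpace Z] {μ : Measure Z}

/-- The quantifier over coefficients is uncountable, so measurability comes from openness: the
strict inequality makes the set a union of open sets. -/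
theorem isOpen_exists_residual_lt {k p : ℕ} (a : ℝ) :
    IsOpen {q : (Fin k → Fin p → ℝ) × (Fin k → ℝ) |
      ∃ c : Fin p → ℝ, ∑ l, (q.2 l - ∑ j, q.1 l j * c j) ^ 2 < a} := by
  simp only [Set.ofPred_exists]
  refine isOpen_iUnion fun c => isOpen_lt ?_ continuous_const
  fun_prop

theorem measurableSet_residual_lt {k p : ℕ} {b : Z → Fin p → ℝ} {g : Z → ℝ} (hb : Measurable b)
    (hg : Measurable g) (a : ℝ) :
    MeasurableSet {z : Fin k → Z | ∃ c : Fin p → ℝ,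
      ∑ l, (g (z l) - ∑ j, b (z l) j * c j) ^ 2 < a} := by
  have hf : Measurable fun z : Fin k → Z => ((fun l => b (z l)), fun l => g (z l)) := by fun_prop
  exact hf (isOpen_exists_residual_lt a).measurableSet

/-- The regressors are independent of the Gaussian response, so Fubini applies: conditionally on the
regressors the subspace is fixed, and the bound is uniform over subspaces. -/
theorem measure_residual_lt_le [IsProbabilityMeasure μ] {k p : ℕ} {b : Z → Fin p → ℝ} {g : Z → ℝ}
    {ρ : Measure (Fin p → ℝ)} [IsProbabilityMeasure ρ]
    (h : MeasurePreserving (fun z => (b z, g z)) μ (ρ.prod (gaussianReal 0 1))) {a : ℝ}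
    {r : ENNReal} (hr : ∀ B : Fin k → Fin p → ℝ, (Measure.pi fun _ : Fin k => gaussianReal 0 1)
        {g | ∃ c : Fin p → ℝ, ∑ l, (g l - ∑ j, B l j * c j) ^ 2 < a} ≤ r) :
    (Measure.pi fun _ : Fin k => μ) {z | ∃ c : Fin p → ℝ,
      ∑ l, (g (z l) - ∑ j, b (z l) j * c j) ^ 2 < a} ≤ r := by
  have h1 : MeasurePreserving (fun (z : Fin k → Z) l => (b (z l), g (z l)))
      (Measure.pi fun _ : Fin k => μ) (Measure.pi fun _ => ρ.prod (gaussianReal 0 1)) :=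
    measurePreserving_pi _ _ fun _ => h
  have h2 := (measurePreserving_arrowProdEquivProdArrow (Fin p → ℝ) ℝ (Fin k) (fun _ => ρ)
    fun _ => gaussianReal 0 1).comp h1
  have hs := (isOpen_exists_residual_lt (k := k) (p := p) a).measurableSet
  have h3 := h2.measure_preimage hs.nullMeasurableSet
  refine (le_of_eq h3).trans ?_
  rw [Measure.prod_apply hs]
  refine (lintegral_mono fun B => hr B).trans ?_
  simp

theorem measure_sum_sq_ge_le [IsProbabilityMeasure μ] {k : ℕ} (hk : 1 ≤ k) {g : Z → ℝ}
    (h : MeasurePreserving g μ (gaussianReal 0 1)) (x : ℝ) :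
    (Measure.pi fun _ : Fin k => μ) {z | k + (3 * x + 2) * √k ≤ ∑ l, g (z l) ^ 2}
      ≤ ENNReal.ofReal (Real.exp (-x)) := by
  have h1 : MeasurePreserving (fun (z : Fin k → Z) l => g (z l))
      (Measure.pi fun _ : Fin k => μ) (Measure.pi fun _ => gaussianReal 0 1) :=
    measurePreserving_pi _ _ fun _ => h
  have hs : MeasurableSet {y : Fin k → ℝ | k + (3 * x + 2) * √k ≤ ∑ l, y l ^ 2} :=
    measurableSet_le measurable_const (by fun_prop)
  refine (le_of_eq (h1.measure_preimage hs.nullMeasurableSet)).trans ?_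
  have := chiSq_upper_tail (Finset.univ : Finset (Fin k))
    ⟨⟨0, hk⟩, Finset.mem_univ _⟩ x
  simp only [Finset.card_univ, Fintype.card_fin] at this
  rw [← ofReal_measureReal]
  exact ENNReal.ofReal_le_ofReal this

end Rows

/-! ### The law of one round, whitened and normalized. -/

section Model

open scoped MatrixOrder

variable {d m : ℕ}

/-- The law of one round: context and noises. -/
noncomputable abbrev rowLaw (S : Matrix (Fin d) (Fin d) ℝ) (σ : Fin m → ℝ) :
    Measure (EuclideanSpace ℝ (Fin d) × (Fin m → ℝ)) :=
  (multivariateGaussian 0 S).prod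
    (Measure.pi fun i => gaussianReal 0 (Real.toNNReal (σ i ^ 2)))

/-- The whitened context `S^(-1/2) x`. -/
noncomputable def whiten (S : Matrix (Fin d) (Fin d) ℝ) (x : EuclideanSpace ℝ (Fin d)) :
    Fin d → ℝ :=
  ((CFC.sqrt S)⁻¹).mulVec x.ofLp

theorem sqrt_mul_sqrt {S : Matrix (Fin d) (Fin d) ℝ} (hS : S.PosDef) :
    CFC.sqrt S * CFC.sqrt S = S :=
  CFC.sqrt_mul_sqrt_self _ hS.posSemidef.nonneg

theorem isUnit_det_sqrt {S : Matrix (Fin d) (Fin d) ℝ} (hS : S.PosDef) :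
    IsUnit (CFC.sqrt S).det := by
  have h := congrArg Matrix.det (sqrt_mul_sqrt hS)
  rw [Matrix.det_mul] at h
  exact isUnit_of_mul_isUnit_left (h ▸ hS.det_pos.ne'.isUnit)

theorem sqrt_transpose (S : Matrix (Fin d) (Fin d) ℝ) : (CFC.sqrt S).transpose = CFC.sqrt S := by
  have h := (CFC.sqrt_nonneg S).isSelfAdjoint
  rw [IsSelfAdjoint, Matrix.star_eq_conjTranspose, Matrix.conjTranspose_eq_transpose_of_trivial] at h
  exact h

theorem measurable_whiten (S : Matrix (Fin d) (Fin d) ℝ) : Measurable (whiten S) := by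
  have : Continuous (whiten S) := by
    unfold whiten
    fun_prop
  exact this.measurable

theorem measurePreserving_whiten {S : Matrix (Fin d) (Fin d) ℝ} (hS : S.PosDef) :
    MeasurePreserving (whiten S) (multivariateGaussian 0 S)
      (Measure.pi fun _ => gaussianReal 0 1) := by
  refine ⟨measurable_whiten S, ?_⟩
  rw [multivariateGaussian, ← map_pi_eq_stdGaussian,
    Measure.map_map (measurable_whiten S) (by fun_prop),
    Measure.map_map ((measurable_whiten S).comp (by fun_prop)) (by fun_prop)]
  convert Measure.map_id using 2
  ext x j
  simp [whiten, Matrix.mulVec_mulVec, Matrix.nonsing_inv_mul _ (isUnit_det_sqrt hS)]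

theorem measurePreserving_noise (S : Matrix (Fin d) (Fin d) ℝ) {σ : Fin m → ℝ}
    (hσ : ∀ i, 0 < σ i) (i : Fin m) :
    MeasurePreserving (fun z : EuclideanSpace ℝ (Fin d) × (Fin m → ℝ) => (z.1.ofLp, z.2 i / σ i))
      (rowLaw S σ) (((multivariateGaussian 0 S).map fun x => x.ofLp).prod (gaussianReal 0 1)) := by
  have h0 : MeasurePreserving (fun x : EuclideanSpace ℝ (Fin d) => x.ofLp)
      (multivariateGaussian 0 S) ((multivariateGaussian 0 S).map fun x => x.ofLp) :=
    ⟨by fun_prop, rfl⟩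
  have := Measure.isProbabilityMeasure_map (μ := multivariateGaussian 0 S) h0.aemeasurable
  have h1 := measurePreserving_eval (fun i => gaussianReal 0 (Real.toNNReal (σ i ^ 2))) i
  have h2 : MeasurePreserving (fun y : ℝ => y / σ i) (gaussianReal 0 (Real.toNNReal (σ i ^ 2)))
      (gaussianReal 0 1) := by
    refine ⟨by fun_prop, ?_⟩
    rw [gaussianReal_map_div_const]
    congr 1
    · simp
    · ext
      have := (hσ i).ne'
      rw [NNReal.coe_div, Real.coe_toNNReal _ (sq_nonneg (σ i))]
      exact div_self (pow_ne_zero 2 this)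
  exact h0.prod (h2.comp h1)

/-- Whitening makes the coordinates independent, so one column can play the response and the
remaining p the regressors, as in the noise regression. -/
theorem measurePreserving_column {p : ℕ} {S : Matrix (Fin (p + 1)) (Fin (p + 1)) ℝ} (hS : S.PosDef)
    (σ : Fin m → ℝ) (j : Fin (p + 1)) :
    MeasurePreserving (fun z : EuclideanSpace ℝ (Fin (p + 1)) × (Fin m → ℝ) =>
        ((fun l => whiten S z.1 (j.succAbove l)), whiten S z.1 j))
      (rowLaw S σ) ((Measure.pi fun _ : Fin p => gaussianReal 0 1).prod (gaussianReal 0 1)) := by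
  have h1 : MeasurePreserving (fun z : EuclideanSpace ℝ (Fin (p + 1)) × (Fin m → ℝ) => z.1)
      (rowLaw S σ) (multivariateGaussian 0 S) := measurePreserving_fst
  have h2 := measurePreserving_piFinSuccAbove (fun _ : Fin (p + 1) => gaussianReal 0 1) j
  exact Measure.measurePreserving_swap.comp (h2.comp ((measurePreserving_whiten hS).comp h1))

end Model
end TraceUCB

namespace TraceUCB
open MeasureTheory

/-! ### Optional skipping. -/

section Skipping

variable {Z : Type*} [MeasurableSpace Z]

/-- The sequences `z` for which the rounds before some time `T` in which the rule `s` (a function of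
the strict past) selects are exactly `k` in number, the selected entries forming an element
of `A`. -/
def skipEvent (n k : ℕ) (s : (t : ℕ) → (Fin t → Z) → Prop) (A : Set (Fin k → Z)) :
    Set (Fin n → Z) :=
  {z | ∃ T : Fin (n + 1), ∃ f : Fin k → Fin n, StrictMono f ∧
    (∀ t : Fin n, ((t : ℕ) < T ∧ s t fun u => z (Fin.castLE t.2.le u)) ↔ t ∈ Set.range f) ∧
    (fun l => z (f l)) ∈ A}

theorem measurableSet_skipEvent {n k : ℕ} {s : (t : ℕ) → (Fin t → Z) → Prop} {A : Set (Fin k → Z)}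
    (hs : ∀ t, MeasurableSet {w | s t w}) (hA : MeasurableSet A) :
    MeasurableSet (skipEvent n k s A) := by
  unfold skipEvent
  simp only [Set.ofPred_exists]
  refine MeasurableSet.iUnion fun T => MeasurableSet.iUnion fun f => ?_
  have h : ∀ t : Fin n, MeasurableSet {z : Fin n → Z |
      ((t : ℕ) < T ∧ s t fun u => z (Fin.castLE t.2.le u)) ↔ t ∈ Set.range f} := by
    intro t
    have h1 : MeasurableSet {z : Fin n → Z | s t fun u => z (Fin.castLE t.2.le u)} := by
      have : Measurable fun (z : Fin n → Z) (u : Fin t) => z (Fin.castLE t.2.le u) := by fun_prop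
      exact this (hs t)
    have h2 : MeasurableSet {z : Fin n → Z |
        (t : ℕ) < T ∧ s t fun u => z (Fin.castLE t.2.le u)} := (MeasurableSet.const _).inter h1
    exact (measurableSet_setOfPred.1 h2).iff measurable_const |> measurableSet_setOfPred.2
  have h' : Measurable fun (z : Fin n → Z) (l : Fin k) => z (f l) := by fun_prop
  have heq : {z : Fin n → Z | StrictMono f ∧
      (∀ t : Fin n, ((t : ℕ) < T ∧ s t fun u => z (Fin.castLE t.2.le u)) ↔ t ∈ Set.range f) ∧
      (fun l => z (f l)) ∈ A} = {_z | StrictMono f} ∩ ((⋂ t : Fin n, {z : Fin n → Z |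
        ((t : ℕ) < T ∧ s t fun u => z (Fin.castLE t.2.le u)) ↔ t ∈ Set.range f}) ∩
      (fun z l => z (f l)) ⁻¹' A) := by
    ext z
    simp
  rw [heq]
  exact (MeasurableSet.const _).inter ((MeasurableSet.iInter h).inter (h' hA))

theorem cons_castLE {Z : Type*} {n t : ℕ} (ht : t + 1 ≤ n + 1) (z : Fin (n + 1) → Z) :
    (fun u : Fin (t + 1) => z (Fin.castLE ht u)) =
      Fin.cons (z 0) fun u : Fin t => Fin.tail z (Fin.castLE (Nat.le_of_succ_le_succ ht) u) := by
  ext u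
  refine Fin.cases ?_ (fun v => ?_) u
  · simp
  · simp [Fin.tail]

theorem exists_shift {n k : ℕ} {f : Fin k → Fin (n + 1)} (hf : StrictMono f)
    (h0 : ∀ l, f l ≠ 0) : ∃ g : Fin k → Fin n, StrictMono g ∧ ∀ l, f l = (g l).succ := by
  refine ⟨fun l => (f l).pred (h0 l), fun a b hab => ?_, fun l => by simp⟩
  simpa using hf hab

theorem measurePreserving_cons (μ : Measure Z) [SigmaFinite μ] (n : ℕ) :
    MeasurePreserving (fun q : Z × (Fin n → Z) => (Fin.cons q.1 q.2 : Fin (n + 1) → Z))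
      (μ.prod (Measure.pi fun _ => μ)) (Measure.pi fun _ => μ) := by
  convert (measurePreserving_piFinSuccAbove (fun _ : Fin (n + 1) => μ) 0).symm using 1
  ext q : 1
  exact (Fin.insertNth_zero' _ _).symm

/-- Optional skipping: the first `k` entries selected by a predictable rule from an i.i.d. sequence
are dominated in law by `k` i.i.d. entries. -/
theorem measure_skipEvent_le (μ : Measure Z) [IsProbabilityMeasure μ] (n : ℕ) :
    ∀ (k : ℕ) (s : (t : ℕ) → (Fin t → Z) → Prop), (∀ t, MeasurableSet {w | s t w}) →
      ∀ A : Set (Fin k → Z), MeasurableSet A →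
      (Measure.pi fun _ : Fin n => μ) (skipEvent n k s A) ≤ (Measure.pi fun _ : Fin k => μ) A := by
  induction n with
  | zero =>
    intro k s _ A _
    cases k with
    | zero =>
      refine (measure_mono (t := A) ?_).trans_eq (by congr)
      rintro z ⟨_, f, _, _, h⟩
      convert h using 1
    | succ k =>
      refine (measure_mono (t := ∅) ?_).trans (by simp)
      rintro z ⟨_, f, _⟩
      exact (f 0).elim0
  | succ n ih =>
    intro k s hs A hA
    cases k with
    | zero =>
      -- There is only one sequence of length 0, so A is everything or empty.
      by_cases hA0 : (Fin.elim0 : Fin 0 → Z) ∈ A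
      · have : A = Set.univ := by
          ext w
          simp [Subsingleton.elim w Fin.elim0, hA0]
        rw [this, measure_univ]
        exact prob_le_one
      · refine (measure_mono (t := ∅) ?_).trans (by simp)
        rintro z ⟨_, f, _, _, h⟩
        exact hA0 (by convert h using 1)
    | succ k =>
      have hcons := measurePreserving_cons μ
      have hmp := hcons n
      have hmpk := hcons k
      have hE := measurableSet_skipEvent (n := n + 1) hs hA
      have hc : ∀ t, Measurable fun q : Z × (Fin t → Z) =>
          (Fin.cons q.1 q.2 : Fin (t + 1) → Z) := fun t => (hcons t).measurable
      have hc' : ∀ t (x : Z), Measurable fun w : Fin t → Z => (Fin.cons x w : Fin (t + 1) → Z) :=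
        fun t x => (hc t).comp measurable_prodMk_left
      have hs' : ∀ (x : Z) (t : ℕ),
          MeasurableSet {w : Fin t → Z | s (t + 1) (Fin.cons x w)} :=
        fun x t => hc' t x (hs (t + 1))
      rw [← hmp.measure_preimage hE.nullMeasurableSet,
        ← hmpk.measure_preimage hA.nullMeasurableSet,
        Measure.prod_apply (hmp.measurable hE), Measure.prod_apply (hmpk.measurable hA)]
      have hsplit : ∀ (x : Z) (w : Fin n → Z),
          (Fin.cons x w : Fin (n + 1) → Z) ∈ skipEvent (n + 1) (k + 1) s A →
          ∃ T : Fin (n + 1), ∃ f : Fin (k + 1) → Fin (n + 1), StrictMono f ∧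
            (s 0 Fin.elim0 ↔ 0 ∈ Set.range f) ∧
            (∀ t : Fin n, ((t : ℕ) < T ∧
              s (t + 1) (Fin.cons x fun u => w (Fin.castLE t.2.le u))) ↔ t.succ ∈ Set.range f) ∧
            (fun l => (Fin.cons x w : Fin (n + 1) → Z) (f l)) ∈ A := by
        rintro x w ⟨T, f, hf, hsel, hfA⟩
        -- At least one round is selected, so the cutoff is positive and survives the shift by one
        -- round.
        have hT : T ≠ 0 := by
          rintro rfl
          simpa using (hsel (f 0)).2 ⟨0, rfl⟩
        obtain ⟨T', rfl⟩ := Fin.exists_succ_eq.2 hT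
        refine ⟨T', f, hf, ?_, fun t => ?_, hfA⟩
        · rw [← hsel 0]
          simp only [Fin.val_zero, Fin.val_succ, Nat.zero_lt_succ, true_and]
          rw [Subsingleton.elim Fin.elim0 fun u : Fin 0 =>
            (Fin.cons x w : Fin (n + 1) → Z) (Fin.castLE (Fin.is_le 0) u)]
          rfl
        · rw [← hsel t.succ]
          simp only [Fin.val_succ, Nat.add_lt_add_iff_right]
          rw [cons_castLE]
          simp
      -- The decision in round 0 sees no data, so it does not depend on x. If the round is taken, x
      -- becomes the first row and k rows remain, constrained by the section of A at x; otherwise x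
      -- only changes the later rule, and the induction hypothesis is uniform over rules.
      by_cases h0 : s 0 Fin.elim0
      · refine lintegral_mono fun x => ?_
        refine (measure_mono ?_).trans
          (ih k (fun t w => s (t + 1) (Fin.cons x w)) (hs' x)
            ((fun w : Fin k → Z => (Fin.cons x w : Fin (k + 1) → Z)) ⁻¹' A) (hc' k x hA))
        intro w hw
        obtain ⟨T, f, hf, hf0, hsel, hfA⟩ := hsplit x w hw
        obtain ⟨l, hl⟩ := hf0.1 h0
        have hf0' : f 0 = 0 := by
          have := hf.monotone (Fin.zero_le l)
          rw [hl] at this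
          exact le_antisymm this (Fin.zero_le _)
        obtain ⟨g, hg, hfg⟩ := exists_shift (hf.comp (Fin.strictMono_succ (n := k)))
          fun l h => (Fin.succ_ne_zero l) (hf.injective (h.trans hf0'.symm))
        simp only [Function.comp_apply] at hfg
        refine ⟨T, g, hg, fun t => ?_, ?_⟩
        · rw [hsel t]
          constructor
          · rintro ⟨l, hl⟩
            cases l using Fin.cases with
            | zero => exact absurd (hf0'.symm.trans hl).symm (Fin.succ_ne_zero t)
            | succ l => exact ⟨l, Fin.succ_injective _ ((hfg l).symm.trans hl)⟩
          · rintro ⟨l, rfl⟩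
            exact ⟨l.succ, hfg l⟩
        · rw [Set.mem_preimage]
          convert hfA using 1
          ext l
          cases l using Fin.cases with
          | zero => simp [hf0']
          | succ l => simp [hfg]
      · have hconst : ∀ x : Z, (Measure.pi fun _ : Fin n => μ)
            (Prod.mk x ⁻¹' ((fun q : Z × (Fin n → Z) => (Fin.cons q.1 q.2 : Fin (n + 1) → Z)) ⁻¹'
              skipEvent (n + 1) (k + 1) s A)) ≤ (Measure.pi fun _ : Fin (k + 1) => μ) A := by
          intro x
          refine (measure_mono ?_).trans
            (ih (k + 1) (fun t w => s (t + 1) (Fin.cons x w)) (hs' x) A hA)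
          intro w hw
          obtain ⟨T, f, hf, hf0, hsel, hfA⟩ := hsplit x w hw
          obtain ⟨g, hg, hfg⟩ := exists_shift hf fun l h => h0 (hf0.2 ⟨l, h⟩)
          refine ⟨T, g, hg, fun t => ?_, ?_⟩
          · rw [hsel t]
            constructor
            · rintro ⟨l, hl⟩
              exact ⟨l, Fin.succ_injective _ ((hfg l).symm.trans hl)⟩
            · rintro ⟨l, rfl⟩
              exact ⟨l, hfg l⟩
          · convert hfA using 1
            ext l
            simp [hfg]
        refine (lintegral_mono hconst).trans ?_
        rw [lintegral_const, measure_univ, mul_one, ← hmpk.measure_preimage hA.nullMeasurableSet,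
          Measure.prod_apply (hmpk.measurable hA)]

end Skipping
end TraceUCB

namespace TraceUCB

/-! ### Diagonal of an inverse Gram matrix. -/

section Gram

open Matrix

variable {κ : Type*} [Fintype κ]

theorem dotProduct_gram_mulVec {d : ℕ} (G : Matrix κ (Fin d) ℝ) (v : Fin d → ℝ) :
    v ⬝ᵥ ((G.transpose * G) *ᵥ v) = ∑ l, (G *ᵥ v) l ^ 2 := by
  rw [← mulVec_mulVec, dotProduct_mulVec, vecMul_transpose]
  simp [dotProduct, sq]

/-- Dividing Gv by v_j gives column j minus a combination of the other columns, whose squared norm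
is at least a. -/
theorem mul_sq_le_gram {p : ℕ} (G : Matrix κ (Fin (p + 1)) ℝ) {a : ℝ} {j : Fin (p + 1)}
    (hG : ∀ c : Fin p → ℝ, a ≤ ∑ l, (G l j - ∑ i, G l (j.succAbove i) * c i) ^ 2)
    (v : Fin (p + 1) → ℝ) : a * v j ^ 2 ≤ ∑ l, (G *ᵥ v) l ^ 2 := by
  by_cases hv : v j = 0
  · rw [hv]
    simpa using Finset.sum_nonneg fun l _ => sq_nonneg ((G *ᵥ v) l)
  · have h := hG fun i => -(v (j.succAbove i) / v j)
    have h1 : ∀ l, G l j - ∑ i, G l (j.succAbove i) * -(v (j.succAbove i) / v j)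
        = (G *ᵥ v) l / v j := by
      intro l
      rw [mulVec, dotProduct, Fin.sum_univ_succAbove _ j, add_div, mul_div_cancel_right₀ _ hv,
        Finset.sum_div, sub_eq_add_neg, ← Finset.sum_neg_distrib]
      congr 1
      exact Finset.sum_congr rfl fun i _ => by ring
    simp only [h1, div_pow, ← Finset.sum_div] at h
    rwa [le_div_iff₀ (by positivity)] at h

variable {p : ℕ} {G : Matrix κ (Fin (p + 1)) ℝ} {a : ℝ}

theorem isUnit_det_gram (ha : 0 < a)
    (hG : ∀ j, ∀ c : Fin p → ℝ, a ≤ ∑ l, (G l j - ∑ i, G l (j.succAbove i) * c i) ^ 2) :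
    IsUnit (G.transpose * G).det := by
  rw [isUnit_iff_ne_zero]
  intro h0
  obtain ⟨v, hv, hv0⟩ := exists_mulVec_eq_zero_iff.2 h0
  apply hv
  ext j
  have h1 := mul_sq_le_gram G (hG j) v
  rw [← dotProduct_gram_mulVec, hv0, dotProduct_zero] at h1
  have h2 : v j ^ 2 ≤ 0 := by
    by_contra hc
    push Not at hc
    nlinarith [mul_pos ha hc]
  exact pow_eq_zero_iff two_ne_zero |>.1 (le_antisymm h2 (sq_nonneg _))

theorem gram_inv_diag_eq {d : ℕ} {G : Matrix κ (Fin d) ℝ} (hdet : IsUnit (G.transpose * G).det)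
    (j : Fin d) :
    ∑ l, (G *ᵥ ((G.transpose * G)⁻¹ *ᵥ Pi.single j 1)) l ^ 2 = (G.transpose * G)⁻¹ j j := by
  rw [← dotProduct_gram_mulVec, mulVec_mulVec, mul_nonsing_inv _ hdet, one_mulVec]
  simp

/-- For w = (GᵀG)⁻¹e_j one has ‖Gw‖² = w_j, so `mul_sq_le_gram` reads a·w_j² ≤ w_j. -/
theorem gram_inv_diag_le (ha : 0 < a)
    (hG : ∀ j, ∀ c : Fin p → ℝ, a ≤ ∑ l, (G l j - ∑ i, G l (j.succAbove i) * c i) ^ 2)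
    (j : Fin (p + 1)) : (G.transpose * G)⁻¹ j j ≤ 1 / a := by
  have hw := gram_inv_diag_eq (isUnit_det_gram ha hG) j
  have h := mul_sq_le_gram G (hG j) ((G.transpose * G)⁻¹ *ᵥ Pi.single j 1)
  have h0 : 0 ≤ (G.transpose * G)⁻¹ j j := hw ▸ Finset.sum_nonneg fun l _ => sq_nonneg _
  rw [hw] at h
  have h2 : ((G.transpose * G)⁻¹ *ᵥ Pi.single j 1) j = (G.transpose * G)⁻¹ j j := by simp
  rw [h2] at h
  rw [le_div_iff₀ ha]
  rcases h0.eq_or_lt with h3 | h3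
  · rw [← h3]; simp
  · by_contra hc
    push Not at hc
    nlinarith

/-- Cauchy–Schwarz for Gw and column j of G, whose inner product is (GᵀGw)_j = 1. -/
theorem one_le_gram_inv_diag_mul {d : ℕ} {G : Matrix κ (Fin d) ℝ}
    (hdet : IsUnit (G.transpose * G).det) (j : Fin d) :
    1 ≤ (G.transpose * G)⁻¹ j j * ∑ l, G l j ^ 2 := by
  set w := (G.transpose * G)⁻¹ *ᵥ Pi.single j 1 with hw
  have h1 : ∑ l, (G *ᵥ w) l * G l j = 1 := by
    have h2 : (G.transpose * G) *ᵥ w = Pi.single j 1 := by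
      rw [hw, mulVec_mulVec, mul_nonsing_inv _ hdet, one_mulVec]
    have h3 := congrFun h2 j
    rw [← mulVec_mulVec] at h3
    simpa [mulVec, dotProduct, mul_comm] using h3
  have h4 := Finset.sum_mul_sq_le_sq_mul_sq Finset.univ (fun l => (G *ᵥ w) l) fun l => G l j
  rw [h1, hw, gram_inv_diag_eq hdet j] at h4
  simpa using h4

end Gram

/-! ### Least squares and whitening of the Gram matrix. -/

section LeastSquares

open Matrix

variable {κ : Type*} [Fintype κ] {d : ℕ}

theorem sum_sq_residual_le (D : Matrix κ (Fin d) ℝ) (Y : κ → ℝ)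
    (hdet : IsUnit (D.transpose * D).det) (b : Fin d → ℝ) :
    ∑ s, (Y s - (D *ᵥ ((D.transpose * D)⁻¹ *ᵥ (D.transpose *ᵥ Y))) s) ^ 2
      ≤ ∑ s, (Y s - (D *ᵥ b) s) ^ 2 := by
  set q := (D.transpose * D)⁻¹ *ᵥ (D.transpose *ᵥ Y) with hq
  -- The normal equations; the claim is then Pythagoras.
  have h1 : D.transpose *ᵥ (Y - D *ᵥ q) = 0 := by
    rw [mulVec_sub, mulVec_mulVec, hq, mulVec_mulVec, mul_nonsing_inv _ hdet, one_mulVec, sub_self]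
  have h2 : (Y - D *ᵥ q) ⬝ᵥ (D *ᵥ (q - b)) = 0 := by
    rw [dotProduct_mulVec, ← mulVec_transpose, h1, zero_dotProduct]
  have h3 : ∀ s, (Y s - (D *ᵥ b) s) ^ 2 = (Y s - (D *ᵥ q) s) ^ 2
      + 2 * ((Y s - (D *ᵥ q) s) * (D *ᵥ (q - b)) s) + (D *ᵥ (q - b)) s ^ 2 := by
    intro s
    rw [mulVec_sub, Pi.sub_apply]
    ring
  simp only [h3, Finset.sum_add_distrib, ← Finset.mul_sum]
  have h4 : ∑ s, (Y s - (D *ᵥ q) s) * (D *ᵥ (q - b)) s = 0 := h2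
  rw [h4]
  have := Finset.sum_nonneg fun s (_ : s ∈ Finset.univ) => sq_nonneg ((D *ᵥ (q - b)) s)
  linarith

open scoped MatrixOrder in
theorem design_gram_eq {S : Matrix (Fin d) (Fin d) ℝ} (hS : S.PosDef) (D : Matrix κ (Fin d) ℝ) :
    D.transpose * D = CFC.sqrt S *
      ((D * (CFC.sqrt S)⁻¹).transpose * (D * (CFC.sqrt S)⁻¹)) * CFC.sqrt S := by
  have h := isUnit_det_sqrt hS
  rw [transpose_mul, transpose_nonsing_inv, sqrt_transpose]
  simp only [Matrix.mul_assoc]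
  rw [nonsing_inv_mul _ h, Matrix.mul_one, ← Matrix.mul_assoc (CFC.sqrt S) (CFC.sqrt S)⁻¹,
    mul_nonsing_inv _ h, Matrix.one_mul]

open scoped MatrixOrder in
theorem isUnit_det_design_gram {S : Matrix (Fin d) (Fin d) ℝ} (hS : S.PosDef)
    {D : Matrix κ (Fin d) ℝ}
    (hdet : IsUnit ((D * (CFC.sqrt S)⁻¹).transpose * (D * (CFC.sqrt S)⁻¹)).det) :
    IsUnit (D.transpose * D).det := by
  have h := isUnit_det_sqrt hS
  rw [design_gram_eq hS D, det_mul, det_mul]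
  exact (h.mul hdet).mul h

open scoped MatrixOrder in
theorem trace_mul_inv_gram {S : Matrix (Fin d) (Fin d) ℝ} (hS : S.PosDef) (D : Matrix κ (Fin d) ℝ)
    (hdet : IsUnit (D.transpose * D).det) {r : ℝ} (hr : r ≠ 0) :
    (S * (r⁻¹ • (D.transpose * D))⁻¹).trace =
      r * ((D * (CFC.sqrt S)⁻¹).transpose * (D * (CFC.sqrt S)⁻¹))⁻¹.trace := by
  have h := isUnit_det_sqrt hS
  have h1 : (r⁻¹ • (D.transpose * D))⁻¹ = r • (D.transpose * D)⁻¹ := by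
    have := inv_smul' (A := D.transpose * D) (Units.mk0 r⁻¹ (inv_ne_zero hr)) hdet
    simpa [Units.smul_def] using this
  rw [h1, Matrix.mul_smul, trace_smul, smul_eq_mul]
  congr 1
  conv_lhs => rw [design_gram_eq hS D]
  rw [Matrix.mul_inv_rev, Matrix.mul_inv_rev]
  conv_lhs => enter [1, 1]; rw [← sqrt_mul_sqrt hS]
  rw [Matrix.mul_assoc, ← Matrix.mul_assoc (CFC.sqrt S) (CFC.sqrt S)⁻¹,
    mul_nonsing_inv _ h, Matrix.one_mul, trace_mul_comm, Matrix.mul_assoc, nonsing_inv_mul _ h,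
    Matrix.mul_one]

end LeastSquares

/-! ### Deterministic bounds for the variance estimate and the trace. -/

section Estimates

open Matrix
open scoped MatrixOrder

variable {d m t : ℕ}

theorem residual_eq {i : Fin m} {h : History d m t} {b : Fin d → ℝ} {s : ℝ} (hs : s ≠ 0)
    {η : Rounds i h → ℝ} (hη : ∀ r, response i h r = (design i h *ᵥ b) r + s * η r)
    (r : Rounds i h) (q : Fin d → ℝ) :
    response i h r - (design i h *ᵥ q) r
      = s * (η r - ∑ j, design i h r j * ((q j - b j) / s)) := by
  have h1 : ∑ j, design i h r j * ((q j - b j) / s)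
      = ((design i h *ᵥ q) r - (design i h *ᵥ b) r) / s := by
    simp only [mulVec, dotProduct]
    rw [← Finset.sum_sub_distrib, Finset.sum_div]
    exact Finset.sum_congr rfl fun j _ => by ring
  rw [hη, h1]
  field_simp
  ring

/-- The fitted residual is s times the noise minus some vector in the column space, so only the
distance to that space matters, and invertibility plays no role. -/
theorem le_varEst {i : Fin m} {h : History d m t} {b : Fin d → ℝ} {s : ℝ} (hs : 0 < s)
    {η : Rounds i h → ℝ} (hη : ∀ r, response i h r = (design i h *ᵥ b) r + s * η r)
    (hd : d < pulls i h) {a : ℝ}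
    (ha : ∀ c : Fin d → ℝ, a ≤ ∑ r, (η r - ∑ j, design i h r j * c j) ^ 2) :
    s ^ 2 * a / (pulls i h - d) ≤ varEst i h := by
  have hd' : (0 : ℝ) < pulls i h - d := sub_pos.2 (by exact_mod_cast hd)
  unfold varEst
  simp only [residual_eq hs.ne' hη, mul_pow, ← Finset.mul_sum]
  rw [one_div, inv_mul_eq_div]
  gcongr
  exact ha _

/-- Least squares does at least as well as the true parameter, whose residual is the noise itself.
-/
theorem varEst_le {i : Fin m} {h : History d m t} {b : Fin d → ℝ} {s : ℝ} (hs : 0 < s)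
    {η : Rounds i h → ℝ} (hη : ∀ r, response i h r = (design i h *ᵥ b) r + s * η r)
    (hd : d < pulls i h) {u : ℝ} (hdet : IsUnit ((design i h).transpose * design i h).det)
    (hu : ∑ r, η r ^ 2 ≤ u) :
    varEst i h ≤ s ^ 2 * u / (pulls i h - d) := by
  have hd' : (0 : ℝ) < pulls i h - d := sub_pos.2 (by exact_mod_cast hd)
  unfold varEst
  rw [one_div, inv_mul_eq_div]
  gcongr
  refine (sum_sq_residual_le (design i h) (response i h) hdet b).trans ?_
  simp only [residual_eq hs.ne' hη, mul_pow, ← Finset.mul_sum, sub_self, zero_div, mul_zero,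
    Finset.sum_const_zero, sub_zero]
  gcongr

variable {p : ℕ} {S : Matrix (Fin (p + 1)) (Fin (p + 1)) ℝ} {i : Fin m} {h : History (p + 1) m t}

theorem trace_bounds (hS : S.PosDef) (hk : 0 < pulls i h) {a u : ℝ} (ha : 0 < a) (hu : 0 < u)
    (hlow : ∀ j, ∀ c : Fin p → ℝ, a ≤ ∑ r : Rounds i h,
      (whiten S (h r.1).1 j - ∑ l, whiten S (h r.1).1 (j.succAbove l) * c l) ^ 2)
    (hup : ∀ j, ∑ r : Rounds i h, whiten S (h r.1).1 j ^ 2 ≤ u) :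
    IsUnit ((design i h).transpose * design i h).det ∧
      (p + 1 : ℕ) * (pulls i h / u) ≤ (S * (empCov i h)⁻¹).trace ∧
      (S * (empCov i h)⁻¹).trace ≤ (p + 1 : ℕ) * (pulls i h / a) := by
  set G := design i h * (CFC.sqrt S)⁻¹ with hG
  have hGw : ∀ r j, G r j = whiten S (h r.1).1 j := by
    intro r j
    have : (CFC.sqrt S)⁻¹ = ((CFC.sqrt S)⁻¹).transpose := by
      rw [transpose_nonsing_inv, sqrt_transpose]
    rw [hG, whiten, ← vecMul_transpose, ← this]
    rfl
  simp only [← hGw] at hlow hup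
  have hdetG := isUnit_det_gram ha hlow
  have hdet := isUnit_det_design_gram hS hdetG
  have hk' : (0 : ℝ) < pulls i h := by exact_mod_cast hk
  refine ⟨hdet, ?_⟩
  rw [empCov, trace_mul_inv_gram hS _ hdet hk'.ne', ← hG]
  have hsum : ∀ v : ℝ, ∑ _j : Fin (p + 1), v = (p + 1 : ℕ) * v := by simp
  constructor
  · rw [mul_div_assoc', mul_comm _ (pulls i h : ℝ), mul_div_assoc]
    gcongr
    rw [div_eq_mul_inv, ← hsum]
    refine Finset.sum_le_sum fun j _ => ?_
    have h1 := one_le_gram_inv_diag_mul hdetG j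
    have h0 : 0 ≤ (G.transpose * G)⁻¹ j j :=
      gram_inv_diag_eq hdetG j ▸ Finset.sum_nonneg fun l _ => sq_nonneg _
    rw [inv_le_iff_one_le_mul₀ hu]
    exact h1.trans (mul_le_mul_of_nonneg_left (hup j) h0)
  · rw [mul_div_assoc', mul_comm _ (pulls i h : ℝ), mul_div_assoc]
    gcongr
    rw [div_eq_mul_one_div, ← hsum]
    exact Finset.sum_le_sum fun j _ => gram_inv_diag_le ha hlow j

end Estimates
end TraceUCB

namespace TraceUCB
open MeasureTheory ProbabilityTheory

/-! ### Bookkeeping for a run of the policy. -/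

section Run

variable {d m : ℕ} (π : Policy d m) (β : Fin m → EuclideanSpace ℝ (Fin d))

/-- The instance selected in round `t + 1`. -/
noncomputable def selected (x : ℕ → EuclideanSpace ℝ (Fin d)) (e : ℕ → Fin m → ℝ) (t : ℕ) : Fin m :=
  π t (run π β x e t)

variable {π β} {x x' : ℕ → EuclideanSpace ℝ (Fin d)} {e e' : ℕ → Fin m → ℝ}

theorem run_apply {t : ℕ} (s : Fin t) :
    run π β x e t s = (x s, selected π β x e s,
      (x s).ofLp ⬝ᵥ (β (selected π β x e s)).ofLp + e s (selected π β x e s)) := by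
  induction t with
  | zero => exact s.elim0
  | succ t ih =>
    cases s using Fin.lastCases with
    | last => simp [run, selected]
    | cast s => simpa [run] using ih s

theorem run_congr {t : ℕ} (hx : ∀ u < t, x u = x' u) (he : ∀ u < t, e u = e' u) :
    run π β x e t = run π β x' e' t := by
  induction t with
  | zero => rfl
  | succ t ih =>
    have h := ih (fun u hu => hx u (hu.trans t.lt_succ_self)) fun u hu => he u (hu.trans t.lt_succ_self)
    simp only [run]
    rw [h, hx t t.lt_succ_self, he t t.lt_succ_self]

theorem pulls_run (i : Fin m) (t : ℕ) :
    pulls i (run π β x e t) = ((Finset.range t).filter fun u => selected π β x e u = i).card := by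
  unfold pulls Rounds
  rw [Fintype.card_subtype]
  simp only [run_apply]
  rw [← Finset.card_map Fin.valEmbedding]
  congr 1
  ext u
  simp only [Finset.mem_map, Finset.mem_filter, Finset.mem_univ, true_and, Fin.valEmbedding_apply,
    Finset.mem_range]
  constructor
  · rintro ⟨s, hs, rfl⟩
    exact ⟨s.2, hs⟩
  · rintro ⟨hu, hs⟩
    exact ⟨⟨u, hu⟩, hs, rfl⟩

theorem pulls_succ (i : Fin m) (t : ℕ) :
    pulls i (run π β x e (t + 1)) =
      pulls i (run π β x e t) + if selected π β x e t = i then 1 else 0 := by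
  rw [pulls_run, pulls_run, Finset.range_add_one, Finset.filter_insert]
  split_ifs with h
  · rw [Finset.card_insert_of_notMem (by simp)]
  · rfl

theorem pulls_mono (i : Fin m) {t t' : ℕ} (h : t ≤ t') :
    pulls i (run π β x e t) ≤ pulls i (run π β x e t') := by
  rw [pulls_run, pulls_run]
  exact Finset.card_le_card (Finset.filter_subset_filter _ (Finset.range_mono h))

theorem sum_pulls (t : ℕ) : ∑ i, pulls i (run π β x e t) = t := by
  simp only [pulls_run]
  rw [← Finset.card_eq_sum_card_fiberwise (t := Finset.univ) (by simp)]
  simp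

/-- A sequence of selected rounds enumerates the rounds of an instance. -/
theorem sum_rounds_eq {n t k : ℕ} {i : Fin m} {f : Fin k → Fin n} (hf : StrictMono f)
    (htn : t ≤ n)
    (hr : ∀ u : Fin n, ((u : ℕ) < t ∧ selected π β x e u = i) ↔ u ∈ Set.range f) (F : ℕ → ℝ) :
    ∑ r : Rounds i (run π β x e t), F r.1 = ∑ l, F (f l) := by
  have hlt : ∀ l, (f l : ℕ) < t := fun l => ((hr (f l)).2 ⟨l, rfl⟩).1
  let φ : Fin k → Rounds i (run π β x e t) := fun l => ⟨⟨f l, hlt l⟩, by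
    rw [run_apply]
    exact ((hr (f l)).2 ⟨l, rfl⟩).2⟩
  have hφ : Function.Bijective φ := by
    constructor
    · intro a b hab
      apply hf.injective
      have := congrArg (fun r => (r.1 : ℕ)) hab
      exact Fin.ext this
    · rintro ⟨r, hrr⟩
      rw [run_apply] at hrr
      obtain ⟨l, hl⟩ := (hr ⟨r, r.2.trans_le htn⟩).1 ⟨r.2, hrr⟩
      refine ⟨l, ?_⟩
      apply Subtype.ext
      apply Fin.ext
      change ((f l : Fin n) : ℕ) = r
      rw [hl]
  exact (hφ.sum_comp fun r => F r.1).symm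

end Run

/-! ### The policy as a predictable selection rule. -/

section Rule

variable {d m : ℕ}

/-- Extension of a finite sequence of rounds by zero. -/
def extendZero {t : ℕ} (w : Fin t → EuclideanSpace ℝ (Fin d) × (Fin m → ℝ)) (u : ℕ) :
    EuclideanSpace ℝ (Fin d) × (Fin m → ℝ) :=
  if h : u < t then w ⟨u, h⟩ else 0

/-- The predictable rule selecting the rounds of instance `i`. -/
def selectRule (π : Policy d m) (β : Fin m → EuclideanSpace ℝ (Fin d)) (i : Fin m) (t : ℕ)
    (w : Fin t → EuclideanSpace ℝ (Fin d) × (Fin m → ℝ)) : Prop :=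
  selected π β (fun u => (extendZero w u).1) (fun u => (extendZero w u).2) t = i

theorem measurable_extendZero {t : ℕ} (u : ℕ) :
    Measurable fun w : Fin t → EuclideanSpace ℝ (Fin d) × (Fin m → ℝ) => extendZero w u := by
  unfold extendZero
  split_ifs
  · exact measurable_pi_apply _
  · exact measurable_const

theorem measurable_response (β : Fin m → EuclideanSpace ℝ (Fin d)) :
    Measurable fun q : (EuclideanSpace ℝ (Fin d) × (Fin m → ℝ)) × Fin m =>
      q.1.1.ofLp ⬝ᵥ (β q.2).ofLp + q.1.2 q.2 := by
  refine measurable_from_prod_countable_left fun i => ?_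
  simp only [dotProduct]
  fun_prop

theorem measurable_run {π : Policy d m} (hπ : ∀ t, Measurable (π t))
    (β : Fin m → EuclideanSpace ℝ (Fin d)) {T : ℕ} (t : ℕ) :
    Measurable fun w : Fin T → EuclideanSpace ℝ (Fin d) × (Fin m → ℝ) =>
      run π β (fun u => (extendZero w u).1) (fun u => (extendZero w u).2) t := by
  induction t with
  | zero => exact measurable_const
  | succ t ih =>
    have hI := (hπ t).comp ih
    refine measurable_pi_iff.2 fun s => ?_
    cases s using Fin.lastCases with
    | last =>
      simp only [run, Fin.snoc_last]
      exact (measurable_extendZero t).fst.prodMk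
        (hI.prodMk ((measurable_response β).comp ((measurable_extendZero t).prodMk hI)))
    | cast s =>
      simp only [run, Fin.snoc_castSucc]
      exact measurable_pi_iff.1 ih s

theorem measurableSet_selectRule {π : Policy d m} (hπ : ∀ t, Measurable (π t))
    (β : Fin m → EuclideanSpace ℝ (Fin d)) (i : Fin m) (t : ℕ) :
    MeasurableSet {w | selectRule π β i t w} :=
  ((hπ t).comp (measurable_run hπ β t)) (measurableSet_singleton i)

/-- The selection after t rounds reads only these rounds, so padding with zeros is harmless. -/
theorem selectRule_iff {π : Policy d m} {β : Fin m → EuclideanSpace ℝ (Fin d)} {i : Fin m}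
    {x : ℕ → EuclideanSpace ℝ (Fin d)} {e : ℕ → Fin m → ℝ} (t : ℕ) :
    selectRule π β i t (fun u => (x u, e u)) ↔ selected π β x e t = i := by
  unfold selectRule selected
  rw [run_congr (x' := x) (e' := e)] <;> intro u hu <;> simp [extendZero, hu]

/-- Any property of `k` rows which fails for the rounds of instance `i` among the first `t` is
witnessed by the skipping event. -/
theorem mem_skipEvent_or {π : Policy d m} {β : Fin m → EuclideanSpace ℝ (Fin d)} {i : Fin m}
    {x : ℕ → EuclideanSpace ℝ (Fin d)} {e : ℕ → Fin m → ℝ} {n t : ℕ} (ht : t ≤ n)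
    {A : Set (Fin (pulls i (run π β x e t)) → EuclideanSpace ℝ (Fin d) × (Fin m → ℝ))}
    (hA : (fun u : Fin n => (x u, e u)) ∉ skipEvent n _ (selectRule π β i) A) :
    ∃ f : Fin (pulls i (run π β x e t)) → Fin n, (fun l => (x (f l), e (f l))) ∉ A ∧
      ∀ F : ℕ → ℝ, ∑ r : Rounds i (run π β x e t), F r.1 = ∑ l, F (f l) := by
  classical
  let s : Finset (Fin n) := Finset.univ.filter fun u => (u : ℕ) < t ∧ selected π β x e u = i
  have hs : s.card = pulls i (run π β x e t) := by
    rw [pulls_run, ← Finset.card_map Fin.valEmbedding]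
    congr 1
    ext u
    simp only [s, Finset.mem_map, Finset.mem_filter, Finset.mem_univ, true_and,
      Fin.valEmbedding_apply, Finset.mem_range]
    constructor
    · rintro ⟨v, hv, rfl⟩
      exact hv
    · intro hu
      exact ⟨⟨u, hu.1.trans_le ht⟩, hu, rfl⟩
  have hr : ∀ u : Fin n, ((u : ℕ) < t ∧ selected π β x e u = i) ↔
      u ∈ Set.range (s.orderEmbOfFin hs) := by
    intro u
    rw [Finset.range_orderEmbOfFin]
    simp [s]
  refine ⟨s.orderEmbOfFin hs, fun hmem => hA ?_,
    sum_rounds_eq (s.orderEmbOfFin hs).strictMono ht hr⟩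
  refine ⟨⟨t, Nat.lt_succ_of_le ht⟩, s.orderEmbOfFin hs, (s.orderEmbOfFin hs).strictMono,
    fun u => ?_, hmem⟩
  rw [← hr u]
  have := selectRule_iff (π := π) (β := β) (i := i) (x := x) (e := e) u
  simp only [Fin.val_castLE]
  rw [this]

end Rule
end TraceUCB

namespace TraceUCB
open MeasureTheory ProbabilityTheory

/-! ### The good event for one instance and one count. -/

section Bounds

/-- Two-sided bounds for the statistics of an instance with noise level `s` and log-confidence
parameter `L`. -/
structure StatBounds {d m t : ℕ} (L s : ℝ) (S : Matrix (Fin d) (Fin d) ℝ) (i : Fin m)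
    (h : History d m t) : Prop where
  var_lower : s ^ 2 * ((pulls i h - d : ℝ) - 2 * √((pulls i h - d) * (2 * L))) / (pulls i h - d)
    ≤ varEst i h
  var_upper : varEst i h
    ≤ s ^ 2 * (pulls i h + (6 * L + 2) * √(pulls i h)) / (pulls i h - d)
  trace_lower : d * (pulls i h / (pulls i h + (6 * L + 2) * √(pulls i h)))
    ≤ (S * (empCov i h)⁻¹).trace
  trace_upper : ∃ a : ℝ, 0 < a ∧
    (pulls i h - d + 1 : ℝ) - 2 * √((pulls i h - d + 1) * (2 * L)) ≤ a ∧
    (S * (empCov i h)⁻¹).trace ≤ d * (pulls i h / a)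

/-- The `k` rows for which one of the four bounds may fail. -/
def badRows {p m : ℕ} (S : Matrix (Fin (p + 1)) (Fin (p + 1)) ℝ) (σ : Fin m → ℝ) (L : ℝ)
    (a b : ℝ) (i : Fin m) (k : ℕ) :
    Set (Fin k → EuclideanSpace ℝ (Fin (p + 1)) × (Fin m → ℝ)) :=
  ({z | ∃ c : Fin (p + 1) → ℝ, ∑ l, ((z l).2 i / σ i - ∑ j, (z l).1.ofLp j * c j) ^ 2 < a} ∪
    {z | k + (3 * (2 * L) + 2) * √k ≤ ∑ l, ((z l).2 i / σ i) ^ 2}) ∪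
  ⋃ j, ({z | ∃ c : Fin p → ℝ,
      ∑ l, (whiten S (z l).1 j - ∑ q, whiten S (z l).1 (j.succAbove q) * c q) ^ 2 < b} ∪
    {z | k + (3 * (2 * L) + 2) * √k ≤ ∑ l, (whiten S (z l).1 j) ^ 2})

variable {p m : ℕ} {S : Matrix (Fin (p + 1)) (Fin (p + 1)) ℝ} {σ : Fin m → ℝ}

theorem measurable_whiten_apply (S : Matrix (Fin (p + 1)) (Fin (p + 1)) ℝ) (j : Fin (p + 1)) :
    Measurable fun z : EuclideanSpace ℝ (Fin (p + 1)) × (Fin m → ℝ) => whiten S z.1 j :=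
  (measurable_pi_apply j).comp ((measurable_whiten S).comp measurable_fst)

theorem measurableSet_badRows (L a b : ℝ) (i : Fin m) (k : ℕ) :
    MeasurableSet (badRows S σ L a b i k) := by
  have hw := measurable_whiten_apply (m := m) S
  have h1 := measurableSet_residual_lt (k := k)
    (b := fun z : EuclideanSpace ℝ (Fin (p + 1)) × (Fin m → ℝ) => z.1.ofLp)
    (g := fun z => z.2 i / σ i) (by fun_prop) (by fun_prop) a
  have h2 : MeasurableSet {z : Fin k → EuclideanSpace ℝ (Fin (p + 1)) × (Fin m → ℝ) |
      k + (3 * (2 * L) + 2) * √k ≤ ∑ l, ((z l).2 i / σ i) ^ 2} :=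
    measurableSet_le measurable_const (by fun_prop)
  have h3 : ∀ j : Fin (p + 1), MeasurableSet
      {z : Fin k → EuclideanSpace ℝ (Fin (p + 1)) × (Fin m → ℝ) | ∃ c : Fin p → ℝ,
        ∑ l, (whiten S (z l).1 j - ∑ q, whiten S (z l).1 (j.succAbove q) * c q) ^ 2 < b} :=
    fun j => measurableSet_residual_lt (measurable_pi_lambda _ fun q => hw (j.succAbove q)) (hw j) b
  have h4 : ∀ j : Fin (p + 1), MeasurableSet {z : Fin k → EuclideanSpace ℝ (Fin (p + 1)) × (Fin m → ℝ) |
      k + (3 * (2 * L) + 2) * √k ≤ ∑ l, (whiten S (z l).1 j) ^ 2} := fun j =>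
    measurableSet_le measurable_const
      (Finset.measurable_sum _ fun l _ => by
        have := (hw j).comp (measurable_pi_apply (X := fun _ : Fin k =>
          EuclideanSpace ℝ (Fin (p + 1)) × (Fin m → ℝ)) l)
        exact this.pow_const 2)
  exact (h1.union h2).union (MeasurableSet.iUnion fun j => (h3 j).union (h4 j))

/-- Radii for which the bad rows are unlikely. -/
theorem exists_badRows_radii (hS : S.PosDef) (hσ : ∀ i, 0 < σ i) {L : ℝ} (hL : 0 ≤ L) {k : ℕ}
    (hk : p + 1 < k) : ∃ a b : ℝ, ((k : ℝ) - (p + 1 : ℕ)) - 2 * √((k - (p + 1 : ℕ)) * (2 * L)) ≤ a ∧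
      0 < b ∧ ((k : ℝ) - (p + 1 : ℕ) + 1) - 2 * √((k - (p + 1 : ℕ) + 1) * (2 * L)) ≤ b ∧
      ∀ i, (Measure.pi fun _ : Fin k => rowLaw S σ) (badRows S σ L a b i k)
        ≤ (2 * (p + 2) : ℕ) * ENNReal.ofReal (Real.exp (-(2 * L))) := by
  have hx : 0 ≤ 2 * L := by positivity
  -- The noise is regressed on all p + 1 columns; below, each column is regressed on the other p,
  -- which leaves one more degree of freedom. Only the second radius must be positive, for
  -- invertibility.
  obtain ⟨a, -, ha, hra⟩ := exists_radius (k := k) (p := p + 1) (N := k - (p + 1)) (by omega)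
    (by omega) hx
  obtain ⟨b, hb0, hb, hrb⟩ := exists_radius (k := k) (p := p) (N := k - (p + 1) + 1) (by omega)
    (by omega) hx
  push_cast [Nat.cast_sub hk.le] at ha hb
  refine ⟨a, b, by push_cast; exact ha, hb0, by push_cast; exact hb, fun i => ?_⟩
  have hn := measurePreserving_noise S hσ i
  have : IsProbabilityMeasure
      ((multivariateGaussian 0 S).map fun x : EuclideanSpace ℝ (Fin (p + 1)) => x.ofLp) :=
    Measure.isProbabilityMeasure_map (by fun_prop)
  set r := ENNReal.ofReal (Real.exp (-(2 * L)))
  have h1 := measure_residual_lt_le (k := k) hn hra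
  have h2 := measure_sum_sq_ge_le (k := k) (by omega) (measurePreserving_snd.comp hn) (2 * L)
  have h3 := fun j => measure_residual_lt_le (k := k) (measurePreserving_column hS σ j) hrb
  have h4 := fun j => measure_sum_sq_ge_le (k := k) (by omega)
    (measurePreserving_snd.comp (measurePreserving_column hS σ j)) (2 * L)
  refine (measure_union_le _ _).trans ?_
  refine (add_le_add ((measure_union_le _ _).trans (add_le_add h1 h2))
    ((measure_iUnion_fintype_le _ _).trans (Finset.sum_le_sum fun j _ =>
      (measure_union_le _ _).trans (add_le_add (h3 j) (h4 j))))).trans ?_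
  simp only [Finset.sum_const, Finset.card_univ, Fintype.card_fin, nsmul_eq_mul]
  apply le_of_eq
  push_cast
  ring

/-- Off the skipping events of the bad rows, the statistics obey the bounds. -/
theorem statBounds_of_notMem {π : Policy (p + 1) m}
    {β : Fin m → EuclideanSpace ℝ (Fin (p + 1))} {i : Fin m}
    {x : ℕ → EuclideanSpace ℝ (Fin (p + 1))} {e : ℕ → Fin m → ℝ} (hS : S.PosDef)
    (hσ : ∀ i, 0 < σ i) {L : ℝ} (hL : 0 ≤ L) {n t : ℕ} (ht : t ≤ n)
    (hk : p + 1 < pulls i (run π β x e t)) {a b : ℝ}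
    (ha : ((pulls i (run π β x e t) : ℝ) - (p + 1 : ℕ))
      - 2 * √((pulls i (run π β x e t) - (p + 1 : ℕ)) * (2 * L)) ≤ a) (hb0 : 0 < b)
    (hb : ((pulls i (run π β x e t) : ℝ) - (p + 1 : ℕ) + 1)
      - 2 * √((pulls i (run π β x e t) - (p + 1 : ℕ) + 1) * (2 * L)) ≤ b)
    (hbad : (fun u : Fin n => (x u, e u)) ∉
      skipEvent n _ (selectRule π β i) (badRows S σ L a b i (pulls i (run π β x e t)))) :
    StatBounds L (σ i) S i (run π β x e t) := by
  obtain ⟨f, hf, hsum⟩ := mem_skipEvent_or ht hbad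
  set k := pulls i (run π β x e t) with hkdef
  simp only [badRows, Set.mem_union, Set.mem_iUnion, Set.mem_ofPred_eq, not_or, not_exists,
    not_lt, not_le] at hf
  obtain ⟨⟨hres, hns⟩, hcol⟩ := hf
  have hk' : (0 : ℝ) < k - (p + 1 : ℕ) := sub_pos.2 (by exact_mod_cast hk)
  have hk0 : (0 : ℝ) < k := by exact_mod_cast (by omega : 0 < k)
  have hu : (0 : ℝ) < k + (6 * L + 2) * √k := by positivity
  let η : Rounds i (run π β x e t) → ℝ := fun r => e r.1 i / σ i
  have hη : ∀ r, response i (run π β x e t) r =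
      (design i (run π β x e t)).mulVec (β i).ofLp r + σ i * η r := by
    rintro ⟨r, hr⟩
    have h1 := hr
    rw [run_apply] at h1
    simp only at h1
    have hσi := (hσ i).ne'
    simp only [response, run_apply, h1, η, Matrix.mulVec, design, Matrix.of_apply, dotProduct]
    field_simp
  have hctx : ∀ (r : Rounds i (run π β x e t)), (run π β x e t r.1).1 = x r.1 := fun r => by
    rw [run_apply]
  have htr := trace_bounds (S := S) (i := i) (h := run π β x e t) hS (by omega : 0 < k) hb0 hu
    (fun j c => by
      simp only [hctx]
      rw [hsum fun r => (whiten S (x r) j - ∑ l, whiten S (x r) (j.succAbove l) * c l) ^ 2]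
      exact (hcol j).1 c)
    (fun j => by
      simp only [hctx]
      rw [hsum fun r => (whiten S (x r) j) ^ 2]
      have := (hcol j).2.le
      rwa [show 3 * (2 * L) = 6 * L by ring] at this)
  constructor
  · refine le_trans ?_ (le_varEst (hσ i) hη hk (a := a) fun c => ?_)
    · gcongr
    · simp only [design, Matrix.of_apply, hctx, η]
      rw [hsum fun r => (e r i / σ i - ∑ j, (x r).ofLp j * c j) ^ 2]
      exact hres c
  · refine varEst_le (hσ i) hη hk htr.1 ?_
    simp only [η]
    rw [hsum fun r => (e r i / σ i) ^ 2]
    have := hns.le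
    rwa [show 3 * (2 * L) = 6 * L by ring] at this
  · exact htr.2.1
  · exact ⟨b, hb0, hb, htr.2.2⟩

end Bounds

/-! ### Union bound over instances and counts. -/

section Union

variable {p m : ℕ} {S : Matrix (Fin (p + 1)) (Fin (p + 1)) ℝ} {σ : Fin m → ℝ}

/-- With high probability the statistics of all instances obey the bounds in all rounds in which
they are defined. -/
theorem measure_not_statBounds_le (hS : S.PosDef) (hσ : ∀ i, 0 < σ i) {L : ℝ} (hL : 0 ≤ L)
    {π : Policy (p + 1) m} (hπ : ∀ t, Measurable (π t))
    (β : Fin m → EuclideanSpace ℝ (Fin (p + 1))) {Ω : Type*} [MeasurableSpace Ω] {P : Measure Ω}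
    [IsProbabilityMeasure P] {X : ℕ → Ω → EuclideanSpace ℝ (Fin (p + 1))}
    {ε : ℕ → Ω → Fin m → ℝ} (hM : IsModel P S σ X ε) (n : ℕ) :
    P {ω | ¬ ∀ i, ∀ t ≤ n, p + 1 < pulls i (run π β (fun t => X t ω) (fun t => ε t ω) t) →
        StatBounds L (σ i) S i (run π β (fun t => X t ω) (fun t => ε t ω) t)}
      ≤ (m * n * (2 * (p + 2)) : ℕ) * ENNReal.ofReal (Real.exp (-(2 * L))) := by
  have hrad : ∀ k : ℕ, ∃ a b : ℝ, p + 1 < k →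
      ((k : ℝ) - (p + 1 : ℕ)) - 2 * √((k - (p + 1 : ℕ)) * (2 * L)) ≤ a ∧
      0 < b ∧ ((k : ℝ) - (p + 1 : ℕ) + 1) - 2 * √((k - (p + 1 : ℕ) + 1) * (2 * L)) ≤ b ∧
      ∀ i, (Measure.pi fun _ : Fin k => rowLaw S σ) (badRows S σ L a b i k)
        ≤ (2 * (p + 2) : ℕ) * ENNReal.ofReal (Real.exp (-(2 * L))) := by
    intro k
    by_cases hk : p + 1 < k
    · obtain ⟨a, b, h⟩ := exists_badRows_radii hS hσ hL hk
      exact ⟨a, b, fun _ => h⟩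
    · exact ⟨0, 0, fun h => absurd h hk⟩
  choose a b hab using hrad
  set r : ENNReal := (2 * (p + 2) : ℕ) * ENNReal.ofReal (Real.exp (-(2 * L))) with hr
  let E : Fin m → ℕ → Set (Fin n → EuclideanSpace ℝ (Fin (p + 1)) × (Fin m → ℝ)) := fun i k =>
    skipEvent n k (selectRule π β i) (badRows S σ L (a k) (b k) i k)
  have hE : ∀ i k, p + 1 < k → (Measure.pi fun _ : Fin n => rowLaw S σ) (E i k) ≤ r := fun i k hk =>
    (measure_skipEvent_le (rowLaw S σ) n k _ (measurableSet_selectRule hπ β i) _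
      (measurableSet_badRows _ _ _ _ _)).trans ((hab k hk).2.2.2 i)
  have hZ : ∀ t, AEMeasurable (fun ω => (X t ω, ε t ω)) P := fun t => (hM.law t).aemeasurable
  have hmap : P.map (fun ω (u : Fin n) => (X u ω, ε u ω)) =
      Measure.pi fun _ : Fin n => rowLaw S σ := by
    rw [(iIndepFun_iff_map_fun_eq_pi_map fun u : Fin n => hZ u).1
      (hM.indep.precomp Fin.val_injective)]
    congr 1
    ext1 u
    exact (hM.law u).map_eq
  have hZn : AEMeasurable (fun ω (u : Fin n) => (X u ω, ε u ω)) P :=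
    aemeasurable_pi_lambda _ fun u => hZ u
  -- The union runs over counts k, not rounds t: one skipping event covers every cutoff at which the
  -- instance has exactly k rows.
  have hsub : {ω | ¬ ∀ i, ∀ t ≤ n, p + 1 < pulls i (run π β (fun t => X t ω) (fun t => ε t ω) t) →
        StatBounds L (σ i) S i (run π β (fun t => X t ω) (fun t => ε t ω) t)} ⊆
      (fun ω (u : Fin n) => (X u ω, ε u ω)) ⁻¹'
        ⋃ i : Fin m, ⋃ k ∈ Finset.Ioc (p + 1) n, E i k := by
    intro ω hω
    by_contra hcon
    apply hω
    intro i t ht hk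
    obtain ⟨h1, h2, h3, -⟩ := hab _ hk
    refine statBounds_of_notMem hS hσ hL ht hk h1 h2 h3 fun hmem => hcon ?_
    refine Set.mem_iUnion.2 ⟨i, Set.mem_iUnion₂.2 ⟨_, Finset.mem_Ioc.2 ⟨hk, ?_⟩, hmem⟩⟩
    refine le_trans ?_ ht
    conv_rhs => rw [← sum_pulls (π := π) (β := β) (x := fun t => X t ω) (e := fun t => ε t ω) t]
    exact Finset.single_le_sum (f := fun i => pulls i (run π β (fun t => X t ω) (fun t => ε t ω) t))
      (fun _ _ => Nat.zero_le _) (Finset.mem_univ i)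
  calc _ ≤ _ := measure_mono hsub
    _ ≤ _ := Measure.le_map_apply hZn _
    _ ≤ ∑ i : Fin m, ∑ k ∈ Finset.Ioc (p + 1) n, r := by
      rw [hmap]
      refine (measure_iUnion_fintype_le _ _).trans (Finset.sum_le_sum fun i _ => ?_)
      refine (measure_biUnion_finset_le _ _).trans (Finset.sum_le_sum fun k hk => ?_)
      exact hE i k (Finset.mem_Ioc.1 hk).1
    _ ≤ ∑ i : Fin m, n * r := by
      refine Finset.sum_le_sum fun i _ => ?_
      rw [Finset.sum_const, nsmul_eq_mul, Nat.card_Ioc]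
      gcongr
      exact Nat.sub_le _ _
    _ = _ := by
      rw [Finset.sum_const, hr]
      simp only [Finset.card_univ, Fintype.card_fin, nsmul_eq_mul]
      push_cast
      ring

end Union
end TraceUCB

namespace TraceUCB

/-! ### Bounds for the score and their comparison. -/

section Score

variable {d m t : ℕ} {n : ℕ} {δ R s L : ℝ} {S : Matrix (Fin d) (Fin d) ℝ} {i : Fin m}
  {h : History d m t}

theorem width_eq (hL : 0 ≤ Real.log (2 * m * n / δ)) :
    width n δ R i h = R * (8 * Real.log (2 * m * n / δ) / √((pulls i h : ℝ) - d)) := by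
  unfold width
  rw [Real.sqrt_mul' _ (sq_nonneg _), Real.sqrt_sq hL, Real.sqrt_div (by norm_num),
    show (64 : ℝ) = 8 ^ 2 by norm_num, Real.sqrt_sq (by norm_num)]
  ring

/-- The width is at least 8Ls²/√(k - d). Of this, 2√(2L) ≤ 2L - 2 pays for underestimating the
variance, and the remaining 6L + 2 offsets exactly the factor by which the trace may fall below d.
-/
theorem le_score (hL : L = Real.log (2 * m * n / δ)) (hL4 : 4 ≤ L) (hs : 0 < s) (hR : s ^ 2 ≤ R)
    (hk : d < pulls i h) (hst : StatBounds L s S i h) :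
    s ^ 2 * d / pulls i h ≤ score n δ R S i h := by
  have hν : (0 : ℝ) < pulls i h - d := sub_pos.2 (by exact_mod_cast hk)
  have hk0 : (0 : ℝ) < pulls i h := by exact_mod_cast (Nat.zero_le d).trans_lt hk
  have hνk : (pulls i h : ℝ) - d ≤ pulls i h := by linarith [Nat.cast_nonneg (α := ℝ) d]
  have hv := hst.var_lower
  have ht := hst.trace_lower
  have hw : width n δ R i h = R * (8 * L / √((pulls i h : ℝ) - d)) := by
    rw [hL, width_eq (by linarith)]
  unfold score
  rw [hw]
  set k : ℝ := (pulls i h : ℝ)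
  set ν : ℝ := k - d
  set y := √ν with hy
  have hy0 : 0 < y := Real.sqrt_pos.2 hν
  have hy2 : y ^ 2 = ν := Real.sq_sqrt hν.le
  set z := √k with hz
  have hz0 : 0 < z := Real.sqrt_pos.2 hk0
  have hz2 : z ^ 2 = k := Real.sq_sqrt hk0.le
  have hyz : y ≤ z := Real.sqrt_le_sqrt hνk
  rw [Real.sqrt_mul hν.le, ← hy] at hv
  set q := √(2 * L)
  have hq : q ≤ L - 1 := Real.sqrt_le_iff.2 ⟨by linarith, by nlinarith⟩
  have h1 : s ^ 2 * ((k + (6 * L + 2) * z) / k) ≤ varEst i h + R * (8 * L / y) := by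
    have h2 : s ^ 2 * (8 * L / y) ≤ R * (8 * L / y) := by gcongr
    have h3 : (k + (6 * L + 2) * z) / k = 1 + (6 * L + 2) / z := by
      rw [← hz2]; field_simp
    have h4 : s ^ 2 * (ν - 2 * (y * q)) / ν = s ^ 2 * (1 - 2 * q / y) := by
      rw [← hy2]; field_simp
    have h5 : (6 * L + 2) / z ≤ (6 * L + 2) / y := by gcongr
    have h6 : (6 * L + 2) / y ≤ (8 * L - 2 * q) / y := by
      gcongr
      linarith
    have h7 : s ^ 2 * (1 + (6 * L + 2) / z) ≤ s ^ 2 * (1 - 2 * q / y) + s ^ 2 * (8 * L / y) := by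
      rw [← mul_add]
      refine mul_le_mul_of_nonneg_left ?_ (sq_nonneg s)
      have : (8 * L - 2 * q) / y = 8 * L / y - 2 * q / y := by ring
      linarith
    rw [h3]
    linarith
  have hu : 0 < k + (6 * L + 2) * z := by positivity
  have hpos : 0 ≤ varEst i h + R * (8 * L / y) := le_trans (by positivity) h1
  calc s ^ 2 * d / k = s ^ 2 * ((k + (6 * L + 2) * z) / k) / k * (d * (k / (k + (6 * L + 2) * z)))
      := by field_simp
    _ ≤ _ := by gcongr

theorem variance_upper_real {s R L y k d : ℝ} (hL64 : 64 ≤ L) (hs : 0 < s) (hR : s ^ 2 ≤ R)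
    (hdL : d ≤ L) (hy : 11 * L ≤ y) (hk : k = y ^ 2 + d) :
    s ^ 2 * (k + (6 * L + 2) * √k) / y ^ 2 ≤ s ^ 2 + 6.2 * R * L / y := by
  have hy0 : 0 < y := by linarith
  have hsk : √k ≤ y + 1 := Real.sqrt_le_iff.2 ⟨by linarith, by nlinarith⟩
  have h2 : k + (6 * L + 2) * √k ≤ y ^ 2 + 6.2 * L * y := by
    have h3 : (6 * L + 2) * √k ≤ (6 * L + 2) * (y + 1) := by gcongr
    have h4 : 64 * y ≤ L * y := by gcongr
    have h5 : L * 704 ≤ L * y := by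
      apply mul_le_mul_of_nonneg_left <;> linarith
    have h6 : (6 * L + 2) * (y + 1) = 6 * (L * y) + 6 * L + 2 * y + 2 := by ring
    rw [hk] at h3 ⊢
    linarith
  calc s ^ 2 * (k + (6 * L + 2) * √k) / y ^ 2 ≤ s ^ 2 * (y ^ 2 + 6.2 * L * y) / y ^ 2 := by
        gcongr
    _ = s ^ 2 + 6.2 * s ^ 2 * L / y := by field_simp
    _ ≤ _ := by gcongr

theorem radius_lower_real {L y : ℝ} (hL64 : 64 ≤ L) (hy : 11 * L ≤ y) :
    √((y ^ 2 + 1) * (2 * L)) ≤ 0.18 * L * y := by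
  have hy0 : 0 < y := by linarith
  refine Real.sqrt_le_iff.2 ⟨by positivity, ?_⟩
  have h1 : (704 : ℝ) ^ 2 ≤ y ^ 2 := by
    apply pow_le_pow_left₀ <;> linarith
  have h2 : (y ^ 2 + 1) * (2 * L) ≤ (1.01 * y ^ 2) * (2 * L) := by
    gcongr
    linarith
  refine h2.trans ?_
  have h3 : (0.18 * L * y) ^ 2 = L * y ^ 2 * (0.0324 * L) := by ring
  have h4 : (1.01 * y ^ 2) * (2 * L) = L * y ^ 2 * 2.02 := by ring
  rw [h3, h4]
  gcongr
  linarith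

/-- Here 14.2 is 6.2 from the variance plus 8 from the width, and 0.36 is twice the 0.18 of
`radius_lower_real`. As L/y ≤ 1/11, replacing the denominator by y² costs at most 0.36 + 15.5 ·
0.36/11 < 1.3. -/
theorem ratio_upper_real {s R L y : ℝ} (hL64 : 64 ≤ L) (hs : 0 < s) (hR : s ^ 2 ≤ R)
    (hy : 11 * L ≤ y) :
    (s ^ 2 + 14.2 * R * L / y) / (y ^ 2 - 0.36 * L * y) ≤ (s ^ 2 + 15.5 * R * L / y) / y ^ 2 := by
  have hy0 : 0 < y := by linarith
  have hL0 : 0 < L := by linarith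
  have hR0 : 0 < R := lt_of_lt_of_le (by positivity) hR
  have h9 : 11 * L * y ≤ y * y := by gcongr
  have h10 : 0 < L * y := by positivity
  have hb' : 0 < y ^ 2 - 0.36 * L * y := by linarith
  rw [div_le_div_iff₀ hb' (by positivity)]
  have h5 : (s ^ 2 + 14.2 * R * L / y) * y ^ 2 = s ^ 2 * y ^ 2 + 14.2 * (R * L * y) := by
    field_simp
  have h6 : (s ^ 2 + 15.5 * R * L / y) * (y ^ 2 - 0.36 * L * y)
      = s ^ 2 * y ^ 2 - 0.36 * (s ^ 2 * (L * y)) + 15.5 * (R * L * y) - 5.58 * (R * L * L) := by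
    field_simp
    ring
  rw [h5, h6]
  have h7 : s ^ 2 * (L * y) ≤ R * (L * y) := by gcongr
  have h8 : R * L * (11 * L) ≤ R * L * y := by gcongr
  have h11 : 0 < R * L * y := by positivity
  linarith

theorem score_le (hL : L = Real.log (2 * m * n / δ)) (hL64 : 64 ≤ L) (hs : 0 < s) (hR : s ^ 2 ≤ R)
    (hdL : d ≤ L) (hk : d < pulls i h) (hy : 11 * L ≤ √((pulls i h : ℝ) - d))
    (hst : StatBounds L s S i h) :
    score n δ R S i h ≤
      d * ((s ^ 2 + 15.5 * R * L / √((pulls i h : ℝ) - d)) / √((pulls i h : ℝ) - d) ^ 2) := by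
  have hν : (0 : ℝ) < pulls i h - d := sub_pos.2 (by exact_mod_cast hk)
  have hk0 : (0 : ℝ) < pulls i h := by exact_mod_cast (Nat.zero_le d).trans_lt hk
  have hv := hst.var_upper
  obtain ⟨b, hb0, hb, ht⟩ := hst.trace_upper
  have hw : width n δ R i h = R * (8 * L / √((pulls i h : ℝ) - d)) := by
    rw [hL, width_eq (by linarith)]
  have hd0 : (0 : ℝ) ≤ d := Nat.cast_nonneg d
  have hR0 : 0 < R := lt_of_lt_of_le (by positivity) hR
  have hvar0 : 0 ≤ varEst i h := by
    unfold varEst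
    exact mul_nonneg (one_div_nonneg.2 hν.le) (Finset.sum_nonneg fun _ _ => sq_nonneg _)
  have hy2 := Real.sq_sqrt hν.le
  rw [← hy2] at hv hb
  unfold score
  rw [hw]
  generalize √((pulls i h : ℝ) - d) = y at *
  have hkν : (pulls i h : ℝ) = y ^ 2 + d := by linarith
  generalize (pulls i h : ℝ) = k at *
  generalize varEst i h = V at *
  generalize (S * (empCov i h)⁻¹).trace = T at *
  have hy0 : 0 < y := by linarith
  have hV : V + R * (8 * L / y) ≤ s ^ 2 + 14.2 * R * L / y := by
    have h1 := variance_upper_real hL64 hs hR hdL hy hkν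
    have h4 : s ^ 2 + 14.2 * R * L / y = s ^ 2 + 6.2 * R * L / y + R * (8 * L / y) := by ring
    linarith
  have hbv : y ^ 2 - 0.36 * L * y ≤ b := by
    have h1 := radius_lower_real hL64 hy
    linarith
  have h9 : 11 * L * y ≤ y * y := by gcongr
  have h10 : 0 < L * y := by
    apply mul_pos <;> linarith
  have hb' : 0 < y ^ 2 - 0.36 * L * y := by linarith
  have hpos : 0 ≤ V + R * (8 * L / y) := add_nonneg hvar0 (by positivity)
  calc (V + R * (8 * L / y)) / k * T
      ≤ (V + R * (8 * L / y)) / k * (d * (k / b)) := by gcongr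
    _ = d * ((V + R * (8 * L / y)) / b) := by field_simp
    _ ≤ d * ((s ^ 2 + 14.2 * R * L / y) / (y ^ 2 - 0.36 * L * y)) := by
      refine mul_le_mul_of_nonneg_left ?_ hd0
      exact div_le_div₀ (hpos.trans hV) hV hb' hbv
    _ ≤ _ := mul_le_mul_of_nonneg_left (ratio_upper_real hL64 hs hR hy) hd0

/-- Lower bound for the number of pulls from the comparison of two scores. -/
theorem allocation_bound {v w q B y k : ℝ} (hv : 0 < v) (hw : 0 < w) (hB : 0 ≤ B) (hk : 0 < k)
    (hq : 0 < q) (hy : √(w * q) ≤ y) (hle : v / k ≤ (w + B / y) / y ^ 2) :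
    v * q - v * (B * √(w * q)) / w ^ 2 ≤ k := by
  set r := √(w * q)
  have hr0 : 0 < r := Real.sqrt_pos.2 (by positivity)
  have hr2 : r ^ 2 = w * q := Real.sq_sqrt (by positivity)
  have hy0 : 0 < y := hr0.trans_le hy
  -- The right side decreases in y, so y may be replaced by its lower bound r; what remains is (wr -
  -- B)(wr + B) ≤ (wr)².
  have h1 : (w + B / y) / y ^ 2 ≤ (w + B / r) / r ^ 2 := by gcongr
  have h2 := hle.trans h1
  rw [div_le_iff₀ hk] at h2
  have h3 : v * r ^ 3 ≤ (w * r + B) * k := by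
    have : v * r ^ 3 ≤ (w + B / r) / r ^ 2 * k * r ^ 3 := by gcongr
    refine this.trans (le_of_eq ?_)
    field_simp
  have hq' : q = r ^ 2 / w := by rw [hr2]; field_simp
  rw [hq']
  have h4 : v * (r ^ 2 / w) - v * (B * r) / w ^ 2 = v * r * (w * r - B) / w ^ 2 := by
    field_simp
  rw [h4, div_le_iff₀ (by positivity)]
  have h5 : 0 < w * r + B := by positivity
  refine le_of_mul_le_mul_left ?_ h5
  nlinarith [mul_le_mul_of_nonneg_left h3 (sq_nonneg w), mul_pos hv hr0, sq_nonneg B,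
    mul_nonneg (mul_pos hv hr0).le (sq_nonneg B)]

end Score

/-! ### Counts after the warm-up, and the last pull. -/

section Warmup

variable {d m n : ℕ} {δ R : ℝ} {S : Matrix (Fin d) (Fin d) ℝ} {π : Policy d m}
  {β : Fin m → EuclideanSpace ℝ (Fin d)}
  {x : ℕ → EuclideanSpace ℝ (Fin d)} {e : ℕ → Fin m → ℝ}

theorem pulls_warmup (hπ : IsTraceUCB n δ R S π) (i : Fin m) :
    pulls i (run π β x e (m * (d + 1))) = d + 1 := by
  rw [pulls_run]
  have : (Finset.range (m * (d + 1))).filter (fun u => selected π β x e u = i)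
      = Finset.Ico (i * (d + 1)) ((i + 1) * (d + 1)) := by
    ext u
    simp only [Finset.mem_filter, Finset.mem_range, Finset.mem_Ico]
    have hi : (i + 1) * (d + 1) ≤ m * (d + 1) := Nat.mul_le_mul_right _ i.2
    have key : u < m * (d + 1) → (selected π β x e u = i ↔ u / (d + 1) = i) := fun hu => by
      rw [Fin.ext_iff, selected, hπ.warmup u hu]
    have key2 : u / (d + 1) = i ↔ i * (d + 1) ≤ u ∧ u < (i + 1) * (d + 1) := by
      rw [Nat.div_eq_iff (by omega : 0 < d + 1)]
      have : (i + 1) * (d + 1) = i * (d + 1) + (d + 1) := by ring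
      omega
    constructor
    · rintro ⟨hu, hs⟩
      exact key2.1 ((key hu).1 hs)
    · intro hu
      have hu' := hu.2.trans_le hi
      exact ⟨hu', (key hu').2 (key2.2 hu)⟩
  rw [this, Nat.card_Ico]
  have : ((i : ℕ) + 1) * (d + 1) = i * (d + 1) + (d + 1) := by ring
  omega

theorem exists_last_pull (i : Fin m) {M N : ℕ} (hMN : M ≤ N)
    (h : pulls i (run π β x e M) < pulls i (run π β x e N)) :
    ∃ t, M ≤ t ∧ t < N ∧ selected π β x e t = i ∧
      pulls i (run π β x e t) + 1 = pulls i (run π β x e N) := by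
  induction N, hMN using Nat.le_induction with
  | base => exact absurd h (lt_irrefl _)
  | succ N hN ih =>
    rw [pulls_succ] at h ⊢
    by_cases hs : selected π β x e N = i
    · exact ⟨N, hN, N.lt_succ_self, hs, by simp [hs]⟩
    · simp only [hs, if_false, add_zero] at h ⊢
      obtain ⟨t, h1, h2, h3, h4⟩ := ih h
      exact ⟨t, h1, h2.trans N.lt_succ_self, h3, h4⟩

end Warmup
end TraceUCB

namespace TraceUCB
open MeasureTheory ProbabilityTheory

/-! ### The allocation bound on the good event. -/

section Allocation

variable {m d n : ℕ} {σ : Fin m → ℝ}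

theorem varMin_le (i : Fin m) : varMin σ ≤ σ i ^ 2 :=
  ciInf_le (Set.finite_range _).bddBelow i

theorem varMin_pos (hm : 1 ≤ m) (hσ : ∀ i, 0 < σ i) : 0 < varMin σ := by
  have : Nonempty (Fin m) := ⟨⟨0, hm⟩⟩
  obtain ⟨i, hi⟩ := exists_eq_ciInf_of_finite (f := fun i => σ i ^ 2)
  rw [varMin, ← hi]
  exact pow_pos (hσ i) 2

theorem optAlloc_eq (hm : 1 ≤ m) (hσ : ∀ i, 0 < σ i) (i : Fin m) :
    optAlloc d n σ i = d + 1 + σ i ^ 2 * ((n - m * (d + 1)) / ∑ j, σ j ^ 2) := by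
  have hne : Nonempty (Fin m) := ⟨⟨0, hm⟩⟩
  have hm0 : (0 : ℝ) < m := by exact_mod_cast hm
  have hT : 0 < ∑ j, σ j ^ 2 :=
    Finset.sum_pos (fun i _ => pow_pos (hσ i) 2) Finset.univ_nonempty
  unfold optAlloc
  field_simp
  ring

theorem optAlloc_le (hm : 1 ≤ m) (hσ : ∀ i, 0 < σ i) (hn : m * (d + 1) < n) (i : Fin m) :
    optAlloc d n σ i ≤ n := by
  obtain ⟨h1, h2, -⟩ := optAlloc_optimal d n σ hm hσ hn
  rw [← h1]
  refine Finset.single_le_sum (f := fun i => optAlloc d n σ i) (fun j _ => ?_) (Finset.mem_univ i)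
  have := h2 j
  have := Nat.cast_nonneg (α := ℝ) d
  linarith

/-- When the statistics obey their bounds throughout, Trace-UCB allocates enough pulls. -/
theorem optAlloc_sub_le_pulls {L δ R : ℝ} {S : Matrix (Fin d) (Fin d) ℝ} {π : Policy d m}
    {β : Fin m → EuclideanSpace ℝ (Fin d)} {x : ℕ → EuclideanSpace ℝ (Fin d)}
    {e : ℕ → Fin m → ℝ} (hd : 1 ≤ d) (hm : 1 ≤ m) (hσ : ∀ i, 0 < σ i) (hR : ∀ i, σ i ^ 2 ≤ R)
    (hL : L = Real.log (2 * m * n / δ)) (hL64 : 64 ≤ L) (hdL : d ≤ L)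
    (hn : 2 * m * (d + 1) < n) (hπ : IsTraceUCB n δ R S π)
    (hst : ∀ i, ∀ t ≤ n, d < pulls i (run π β x e t) → StatBounds L (σ i) S i (run π β x e t))
    (i : Fin m) :
    optAlloc d n σ i - 16 * R * L / varMin σ * √(n / lamMin σ) - (d + 1)
      ≤ pulls i (run π β x e n) := by
  have hne : Nonempty (Fin m) := ⟨⟨0, hm⟩⟩
  have hn' : m * (d + 1) < n := lt_of_le_of_lt (by nlinarith) hn
  have hT : 0 < ∑ j, σ j ^ 2 :=
    Finset.sum_pos (fun i _ => pow_pos (hσ i) 2) Finset.univ_nonempty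
  have hv0 := varMin_pos hm hσ
  have hd0 : (0 : ℝ) < d := by exact_mod_cast hd
  have hL0 : 0 < L := by linarith
  have hvR : varMin σ ≤ R := (varMin_le i).trans (hR i)
  have hR0 : 0 < R := hv0.trans_le hvR
  have hn0 : (0 : ℝ) < n := by exact_mod_cast (Nat.zero_le _).trans_lt hn
  have hlam : 0 < lamMin σ := div_pos hv0 hT
  set N : ℝ := n - m * (d + 1) with hN
  have hN2 : (n : ℝ) ≤ 2 * N := by
    have : ((2 * m * (d + 1) : ℕ) : ℝ) < n := by exact_mod_cast hn
    push_cast at this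
    linarith
  have hNn : N ≤ n := by
    have : (0 : ℝ) ≤ m * (d + 1) := by positivity
    linarith
  set q := N / ∑ j, σ j ^ 2 with hq
  have hq0 : 0 < q := div_pos (by linarith) hT
  have hopt : ∀ j, optAlloc d n σ j = d + 1 + σ j ^ 2 * q := optAlloc_eq hm hσ
  -- If the loss exceeds the target, there is nothing to prove. Otherwise, as the target is at most
  -- n, √(λ_min n) > 16L, which supplies the largeness condition of `score_le`.
  by_cases htriv : optAlloc d n σ i ≤ 16 * R * L / varMin σ * √(n / lamMin σ)
  · have : (0 : ℝ) ≤ pulls i (run π β x e n) := Nat.cast_nonneg _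
    linarith
  push Not at htriv
  have hreg : 16 * L < √(lamMin σ * n) := by
    have h1 := htriv.trans_le (optAlloc_le hm hσ hn' i)
    have h2 : 16 * L ≤ 16 * R * L / varMin σ := by
      rw [le_div_iff₀ hv0]
      nlinarith
    have h3 : 16 * L * √(n / lamMin σ) < n :=
      lt_of_le_of_lt (mul_le_mul_of_nonneg_right h2 (Real.sqrt_nonneg _)) h1
    have h4 : √(lamMin σ * n) * √(n / lamMin σ) = n := by
      rw [← Real.sqrt_mul (by positivity), show lamMin σ * n * (n / lamMin σ) = (n : ℝ) ^ 2 by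
        field_simp, Real.sqrt_sq hn0.le]
    exact lt_of_mul_lt_mul_right (h3.trans_eq h4.symm) (Real.sqrt_nonneg _)
  -- Pigeonhole: actual and optimal counts both sum to n.
  obtain ⟨j, hj⟩ : ∃ j, optAlloc d n σ j ≤ pulls j (run π β x e n) := by
    by_contra! hcon
    have h1 := Finset.sum_lt_sum_of_nonempty (s := Finset.univ) Finset.univ_nonempty
      (fun j _ => hcon j)
    rw [(optAlloc_optimal d n σ hm hσ hn').1, ← Nat.cast_sum, sum_pulls] at h1
    exact lt_irrefl _ h1
  have hσj : 0 < σ j ^ 2 := pow_pos (hσ j) 2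
  have hσi : 0 < σ i ^ 2 := pow_pos (hσ i) 2
  have hvj := varMin_le (σ := σ) j
  rw [hopt] at hj
  obtain ⟨t, hMt, htn, hsel, hpt⟩ := exists_last_pull (π := π) (β := β) (x := x) (e := e) j
    (M := m * (d + 1)) hn'.le (by
      rw [pulls_warmup hπ]
      have h1 : (d + 1 : ℝ) < pulls j (run π β x e n) := by
        have := mul_pos hσj hq0
        linarith
      exact_mod_cast h1)
  have hwarm : ∀ l, d < pulls l (run π β x e t) := fun l => by
    have h1 := pulls_mono (π := π) (β := β) (x := x) (e := e) l hMt
    rw [pulls_warmup hπ] at h1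
    omega
  have hcomp := hπ.argmax t hMt htn (run π β x e t) i
  rw [show π t (run π β x e t) = j from hsel] at hcomp
  -- The offset d + 1 in the optimal allocation covers d and the one pull still to come at t.
  have hkj : σ j ^ 2 * q ≤ pulls j (run π β x e t) - d := by
    have : (pulls j (run π β x e t) : ℝ) + 1 = pulls j (run π β x e n) := by exact_mod_cast hpt
    linarith
  set y := √((pulls j (run π β x e t) : ℝ) - d) with hy
  have hy1 : √(σ j ^ 2 * q) ≤ y := Real.sqrt_le_sqrt hkj
  have hy11 : 11 * L ≤ y := by
    refine le_trans ?_ hy1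
    -- Since n ≤ 2N, a factor 2 < (16/11)² is enough; this is how 16L becomes 11L.
    have h1 : lamMin σ * n ≤ (16 / 11) ^ 2 * (σ j ^ 2 * q) := by
      have h2 : lamMin σ * n ≤ 2 * (lamMin σ * N) := by nlinarith
      have h3 : lamMin σ * N ≤ σ j ^ 2 * q := by
        rw [lamMin, hq, div_mul_eq_mul_div, mul_div_assoc']
        gcongr
        linarith
      nlinarith
    have h2 := hreg.le.trans (Real.sqrt_le_sqrt h1)
    rw [Real.sqrt_mul (by positivity), Real.sqrt_sq (by norm_num)] at h2
    linarith
  have hlow := le_score (n := n) (δ := δ) hL (by linarith) (hσ i) (hR i) (hwarm i)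
    (hst i t htn.le (hwarm i))
  have hup := score_le (n := n) (δ := δ) hL hL64 (hσ j) (hR j) hdL (hwarm j) hy11
    (hst j t htn.le (hwarm j))
  rw [← hy] at hup
  have hki : (0 : ℝ) < pulls i (run π β x e t) := by
    exact_mod_cast (Nat.zero_le d).trans_lt (hwarm i)
  have hle : σ i ^ 2 / pulls i (run π β x e t) ≤ (σ j ^ 2 + 15.5 * R * L / y) / y ^ 2 := by
    have h1 := hlow.trans (hcomp.trans hup)
    rw [mul_comm (σ i ^ 2), mul_div_assoc] at h1
    exact le_of_mul_le_mul_left h1 hd0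
  have hfin := allocation_bound hσi hσj (by positivity : 0 ≤ 15.5 * R * L) hki hq0 hy1 hle
  have hmono : (pulls i (run π β x e t) : ℝ) ≤ pulls i (run π β x e n) := by
    exact_mod_cast pulls_mono i htn.le
  have hloss : σ i ^ 2 * (15.5 * R * L * √(σ j ^ 2 * q)) / (σ j ^ 2) ^ 2
      ≤ 16 * R * L / varMin σ * √(n / lamMin σ) := by
    have hσT : σ i ^ 2 ≤ ∑ l, σ l ^ 2 :=
      Finset.single_le_sum (f := fun l => σ l ^ 2) (fun l _ => sq_nonneg _) (Finset.mem_univ i)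
    have h1 : (∑ l, σ l ^ 2) * √(σ j ^ 2 * q) / σ j ^ 2 ≤ √(n / lamMin σ) := by
      apply Real.le_sqrt_of_sq_le
      rw [div_pow, mul_pow, Real.sq_sqrt (by positivity), lamMin, div_div_eq_mul_div,
        div_le_div_iff₀ (by positivity) hv0, hq]
      have h2 : (∑ l, σ l ^ 2) ^ 2 * (σ j ^ 2 * (N / ∑ l, σ l ^ 2)) * varMin σ
          = N * (∑ l, σ l ^ 2) * (σ j ^ 2 * varMin σ) := by
        field_simp
      rw [h2, sq (σ j ^ 2)]
      gcongr
    have h3 : σ i ^ 2 * √(σ j ^ 2 * q) / (σ j ^ 2) ^ 2 ≤ √(n / lamMin σ) / varMin σ := by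
      rw [le_div_iff₀ hv0]
      refine le_trans ?_ h1
      rw [div_mul_eq_mul_div, div_le_div_iff₀ (by positivity) hσj]
      have h4 : σ i ^ 2 * √(σ j ^ 2 * q) * varMin σ * σ j ^ 2
          ≤ (∑ l, σ l ^ 2) * √(σ j ^ 2 * q) * σ j ^ 2 * σ j ^ 2 := by
        gcongr
      exact h4.trans_eq (by ring)
    calc σ i ^ 2 * (15.5 * R * L * √(σ j ^ 2 * q)) / (σ j ^ 2) ^ 2
        = 15.5 * R * L * (σ i ^ 2 * √(σ j ^ 2 * q) / (σ j ^ 2) ^ 2) := by ring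
      _ ≤ 16 * R * L * (√(n / lamMin σ) / varMin σ) := by
        gcongr
        norm_num
      _ = _ := by ring
  rw [hopt]
  linarith

end Allocation

/-- Each tail is taken at level exp(-2L) = (δ/2mn)². The square leaves a spare factor of order 1/n,
which absorbs the d + 1 coordinates. -/
theorem natCast_mul_exp_le {d m n : ℕ} {δ : ℝ} (hm : 1 ≤ m) (hδ : 0 < δ) (hδ1 : δ ≤ 1)
    (hn : d + 1 ≤ n) :
    ((m * n * (2 * (d + 1)) : ℕ) : ENNReal)
      * ENNReal.ofReal (Real.exp (-(2 * Real.log (2 * m * n / δ)))) ≤ ENNReal.ofReal δ := by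
  have hm0 : (1 : ℝ) ≤ m := by exact_mod_cast hm
  have hn0 : (d + 1 : ℝ) ≤ n := by exact_mod_cast hn
  have hd0 : (0 : ℝ) ≤ d := Nat.cast_nonneg d
  have hn1 : (0 : ℝ) < n := by linarith
  have hX : 0 < 2 * m * n / δ := by positivity
  have hexp : Real.exp (-(2 * Real.log (2 * m * n / δ))) = (δ / (2 * m * n)) ^ 2 := by
    rw [Real.exp_neg, two_mul, Real.exp_add, Real.exp_log hX]
    field_simp
  rw [hexp, ← ENNReal.ofReal_natCast, ← ENNReal.ofReal_mul (Nat.cast_nonneg _)]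
  apply ENNReal.ofReal_le_ofReal
  push_cast
  rw [div_pow, mul_div_assoc', div_le_iff₀ (by positivity)]
  have h1 : (m * n * (2 * (d + 1))) * δ ^ 2 ≤ (m * n * (2 * n)) * (δ * 1) := by
    rw [sq]
    gcongr
  refine h1.trans ?_
  have h2 : δ * (2 * m * n) ^ 2 = (m * n * (2 * n)) * (δ * 1) * (2 * m) := by ring
  rw [h2]
  exact le_mul_of_one_le_right (by positivity) (by linarith)

end TraceUCB

theorem theorem1 (d m : ℕ) (hd : 1 ≤ d) (hm : 1 ≤ m) (σ : Fin m → ℝ) (hσ : ∀ i, 0 < σ i) :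
    ∃ c : ℝ, 0 < c ∧
      ∀ (n : ℕ), m * (d + 1) < n →
      ∀ (δ : ℝ), 0 < δ →
      ∀ (R : ℝ), (∀ i, σ i ^ 2 ≤ R) →
      ∀ (S : Matrix (Fin d) (Fin d) ℝ), S.PosDef →
      ∀ (β : Fin m → EuclideanSpace ℝ (Fin d)) (π : TraceUCB.Policy d m),
        TraceUCB.IsTraceUCB n δ R S π →
      ∀ (Ω : Type*) [MeasurableSpace Ω] (P : MeasureTheory.Measure Ω)
        [MeasureTheory.IsProbabilityMeasure P]
        (X : ℕ → Ω → EuclideanSpace ℝ (Fin d)) (ε : ℕ → Ω → Fin m → ℝ),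
        TraceUCB.IsModel P S σ X ε →
        ENNReal.ofReal (1 - δ) ≤
          P {ω | ∀ i : Fin m,
            TraceUCB.optAlloc d n σ i
              - (TraceUCB.CDelta m n δ R + 8 * TraceUCB.CTr d m n δ) / TraceUCB.varMin σ
                * Real.sqrt (n * d / TraceUCB.lamMin σ)
              - c * (n : ℝ) ^ (1 / 4 : ℝ)
            ≤ (TraceUCB.pulls i
                (TraceUCB.run π β (fun t => X t ω) (fun t => ε t ω) n) : ℝ)} := by
  have hm0 : (1 : ℝ) ≤ m := by exact_mod_cast hm
  have hd0 : (1 : ℝ) ≤ d := by exact_mod_cast hd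
  have hv0 := TraceUCB.varMin_pos hm hσ
  -- Beyond this threshold L ≥ log n ≥ 64 + d and n > 2m(d + 1). Below it the optimal allocation is
  -- at most n ≤ n₀ ≤ c, so the bound holds surely.
  set n₀ : ℝ := Real.exp (64 + d) + 2 * m * (d + 1) with hn₀
  refine ⟨n₀ + (d + 1), by positivity, fun n hn δ hδ R hR S hS β π hπ Ω _ P _ X ε hM => ?_⟩
  rcases le_or_gt 1 δ with hδ1 | hδ1
  · rw [ENNReal.ofReal_of_nonpos (by linarith)]
    exact zero_le
  have hn1 : (1 : ℝ) ≤ n := by exact_mod_cast (by omega : 1 ≤ n)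
  have hroot : 1 ≤ (n : ℝ) ^ (1 / 4 : ℝ) := Real.one_le_rpow hn1 (by norm_num)
  have hcroot : n₀ + (d + 1) ≤ (n₀ + (d + 1)) * (n : ℝ) ^ (1 / 4 : ℝ) :=
    le_mul_of_one_le_right (by positivity) hroot
  have hX1 : (n : ℝ) ≤ 2 * m * n / δ := by
    rw [le_div_iff₀ hδ]
    nlinarith
  have hlogn : Real.log n ≤ Real.log (2 * m * n / δ) := Real.log_le_log (by linarith) hX1
  set L := Real.log (2 * m * n / δ) with hL
  have hL0 : 0 ≤ L := (Real.log_nonneg hn1).trans hlogn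
  have hR0 : 0 ≤ R := (sq_nonneg _).trans (hR ⟨0, hm⟩)
  have hCTr : 0 ≤ TraceUCB.CTr d m n δ := by
    unfold TraceUCB.CTr
    positivity
  have hCD : TraceUCB.CDelta m n δ R = 16 * R * L := rfl
  have hlead : 16 * R * L / TraceUCB.varMin σ * √(n / TraceUCB.lamMin σ) ≤
      (TraceUCB.CDelta m n δ R + 8 * TraceUCB.CTr d m n δ) / TraceUCB.varMin σ
        * √(n * d / TraceUCB.lamMin σ) := by
    have hlam : 0 < TraceUCB.lamMin σ := by
      have : Nonempty (Fin m) := ⟨⟨0, hm⟩⟩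
      exact div_pos hv0 (Finset.sum_pos (fun i _ => pow_pos (hσ i) 2) Finset.univ_nonempty)
    rw [hCD]
    gcongr
    · linarith
    · exact le_mul_of_one_le_right (by linarith) hd0
  rcases le_or_gt (n : ℝ) n₀ with hsmall | hbig
  · have huniv : {ω | ∀ i : Fin m,
            TraceUCB.optAlloc d n σ i
              - (TraceUCB.CDelta m n δ R + 8 * TraceUCB.CTr d m n δ) / TraceUCB.varMin σ
                * Real.sqrt (n * d / TraceUCB.lamMin σ)
              - (n₀ + (d + 1)) * (n : ℝ) ^ (1 / 4 : ℝ)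
            ≤ (TraceUCB.pulls i
                (TraceUCB.run π β (fun t => X t ω) (fun t => ε t ω) n) : ℝ)} = Set.univ := by
      refine Set.eq_univ_of_forall fun ω i => ?_
      have h1 := TraceUCB.optAlloc_le hm hσ hn i
      have h2 : (0 : ℝ) ≤ TraceUCB.pulls i
        (TraceUCB.run π β (fun t => X t ω) (fun t => ε t ω) n) := Nat.cast_nonneg _
      have h3 : 0 ≤ 16 * R * L / TraceUCB.varMin σ * √(n / TraceUCB.lamMin σ) := by positivity
      linarith
    rw [huniv, MeasureTheory.measure_univ]
    exact ENNReal.ofReal_le_one.2 (by linarith)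
  have hLbig : 64 + d ≤ L := by
    refine le_trans ?_ hlogn
    rw [Real.le_log_iff_exp_le (by linarith)]
    have : (0 : ℝ) ≤ 2 * m * (d + 1) := by positivity
    linarith
  have hn2 : 2 * m * (d + 1) < n := by
    have : 2 * m * (d + 1) < (n : ℝ) := by
      have := Real.exp_pos (64 + d)
      linarith
    exact_mod_cast this
  obtain ⟨p, rfl⟩ : ∃ p, d = p + 1 := ⟨d - 1, by omega⟩
  have hprob := TraceUCB.measure_not_statBounds_le hS hσ hL0 hπ.measurable β hM n
  have hbad := hprob.trans (TraceUCB.natCast_mul_exp_le (d := p + 1) hm hδ hδ1.le (by nlinarith))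
  -- Subadditivity over the target event and the failure event, which needs neither to be
  -- measurable.
  have hone : (1 : ENNReal) ≤ P {ω | ∀ i : Fin m,
            TraceUCB.optAlloc (p + 1) n σ i
              - (TraceUCB.CDelta m n δ R + 8 * TraceUCB.CTr (p + 1) m n δ) / TraceUCB.varMin σ
                * Real.sqrt (n * (p + 1 : ℕ) / TraceUCB.lamMin σ)
              - (n₀ + ((p + 1 : ℕ) + 1)) * (n : ℝ) ^ (1 / 4 : ℝ)
            ≤ (TraceUCB.pulls i
                (TraceUCB.run π β (fun t => X t ω) (fun t => ε t ω) n) : ℝ)}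
        + ENNReal.ofReal δ := by
    rw [← MeasureTheory.measure_univ (μ := P)]
    refine le_trans (MeasureTheory.measure_mono fun ω _ => ?_)
      ((MeasureTheory.measure_union_le _ _).trans (add_le_add_right hbad _))
    by_contra hcon
    rw [Set.mem_union, not_or] at hcon
    obtain ⟨h1, h2⟩ := hcon
    apply h1
    have hst := not_not.1 h2
    intro i
    have h3 := TraceUCB.optAlloc_sub_le_pulls hd hm hσ hR hL (by linarith) (by linarith) hn2 hπ
      hst i
    have h4 : 0 ≤ n₀ := by positivity
    linarith
  rw [ENNReal.ofReal_sub _ hδ.le, ENNReal.ofReal_one]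
  exact tsub_le_iff_right.2 hone
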